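/- Let $n \ge 0$ be an integer and let $M \sim \mathrm{GOE}_{2n+1}$, i.e. $M$ is a random real symmetric $(2n+1)\times(2n+1)$ matrix whose entries on and above the diagonal are independent centred Gaussian random variables, with variance $2$ on the diagonal and variance $1$ off the diagonal. Let $X, Y_1, \dots, Y_n$ be independent random variables with $X \sim N(0,1)$ and $Y_i \sim \chi^2_{2i+1}$ for $1 \le i \le n$. Then $\det M$ has the same moments as the product $\sqrt{2}\, X \prod_{i=1}^{n} Y_i$: for every integer $k \ge 0$, the $k$-th moments of both random variables exist (are finite), and $$\mathbb{E}\big[(\det M)^k\big] = \mathbb{E}\Big[\Big(\sqrt{2}\, X \prod_{i=1}^{n} Y_i\Big)^{k}\Big].$$ -/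

import Mathlib

open MeasureTheory ProbabilityTheory

/-- The random `N × N` real matrix `M` belongs to the Gaussian Orthogonal Ensemble `GOE_N`:
it is (almost surely) symmetric, its entries on and above the diagonal are independent, and they
are centred normal, with variance `2` on the diagonal and variance `1` off the diagonal.
Equivalently, the density of `M` on symmetric matrices is proportional to `exp (-tr (M ^ 2) / 4)`. -/
structure IsGOE {Ω : Type*} [MeasurableSpace Ω] (N : ℕ) (M : Ω → Matrix (Fin N) (Fin N) ℝ)
    (P : Measure Ω) : Prop where
  isSymm : ∀ᵐ ω ∂P, (M ω).IsSymm
  hasLaw_diag : ∀ i : Fin N, HasLaw (fun ω => M ω i i) (gaussianReal 0 2) P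
  hasLaw_offDiag : ∀ i j : Fin N, i < j → HasLaw (fun ω => M ω i j) (gaussianReal 0 1) P
  iIndepFun_entries :
    iIndepFun (fun (p : {p : Fin N × Fin N // p.1 ≤ p.2}) ω => M ω p.1.1 p.1.2) P

/-- The `χ²` distribution with `k ≥ 1` degrees of freedom, that is, the probability measure on
`[0, ∞)` with density `x ^ (k / 2 - 1) * exp (-x / 2) / (2 ^ (k / 2) * Γ (k / 2))`: the Gamma
distribution of shape `k / 2` and rate `1 / 2`. -/
noncomputable def chiSquared (k : ℕ) : Measure ℝ :=
  gammaMeasure ((k : ℝ) / 2) (1 / 2)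

/-! Odd moments vanish on both sides: `det (-M) = -det M` in odd size, and `X` is symmetric. For
even exponents one follows the joint moments of two consecutive leading minors. Border a GOE matrix
`x` by an independent Gaussian column `v` with corner `a`. The law of `x` is invariant under
orthogonal conjugation, so `v` may be replaced by `|v|` times the last basis vector, and the
determinant becomes `a * det x - |v|^2 * det x'`, where `x'` is the leading minor of `x`. Expanding
the power and integrating out `a` and `|v|^2` gives a closed recursion (`goeMoment_succ`).

The recursion is solved by the series `F_b = ((1 + r) / 2)^(1/2) r^(-b)` with `r = (1 - 4 s)^(1/2)`.
For exponent `2 m`, the suitably normalised moments are, up to a constant `A`, the coefficients of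
`s^i` in `F_(n+1)` at size `2 n + 1`, and of `s^(m-i)` in `F_(n+2+2i)` at size `2 n + 2`. The step
from odd to even size is multiplication by `r^(-2i-1)` (`even_of_odd`). The step from even to odd
size iterates the differential equation of `F_b` and then inverts a binomial transform
(`odd_of_even`). Two steps multiply `A` by the `2m`-th moment of `χ²_(2n+3)`, that is, by the
contribution of one new factor `Y`. At size one `A` is the `2m`-th moment of `√2 X`, and `i = 0`
gives the result.

Finally, a comparison of characteristic functions identifies every matrix satisfying `IsGOE` with
the bordering model `goe` (`IsGOE.map_eq_goe`). -/

/-! ### Power series in `r = (1 - 4 s)^(1/2)` and their differential equations -/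

/-- The generating function `(1 - 4 s) ^ (-1 / 2)` of the central binomial coefficients. -/
noncomputable def centralBinomSeries : PowerSeries ℝ :=
  PowerSeries.mk fun l => (Nat.centralBinom l : ℝ)

theorem one_sub_four_mul_derivative_centralBinomSeries :
    (1 - 4 * PowerSeries.X) * PowerSeries.derivative ℝ centralBinomSeries
      = 2 * centralBinomSeries := by
  ext l
  have h4 : (4 : PowerSeries ℝ) = PowerSeries.C (4 : ℝ) := (map_ofNat PowerSeries.C 4).symm
  have h2 : (2 : PowerSeries ℝ) = PowerSeries.C (2 : ℝ) := (map_ofNat PowerSeries.C 2).symm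
  rw [sub_mul, one_mul, mul_assoc, h4, h2, map_sub, PowerSeries.coeff_C_mul,
    PowerSeries.coeff_C_mul]
  rcases l with _ | l
  · simp [centralBinomSeries, PowerSeries.coeff_derivative, Nat.centralBinom]
  · rw [PowerSeries.coeff_succ_X_mul]
    simp only [centralBinomSeries, PowerSeries.coeff_derivative, PowerSeries.coeff_mk]
    have h := Nat.succ_mul_centralBinom_succ (l + 1)
    have h' : ((l + 1 + 1 : ℕ) : ℝ) * (Nat.centralBinom (l + 1 + 1) : ℝ)
      = 2 * (2 * ((l + 1 : ℕ) : ℝ) + 1) * (Nat.centralBinom (l + 1) : ℝ) := by exact_mod_cast h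
    push_cast at h' ⊢
    linear_combination h'

/-- Both sides have the same derivative and the same constant term. This is the relation `r^2 = 1 -
4 s` for `r^(-1)`. -/
theorem centralBinomSeries_sq_mul : centralBinomSeries ^ 2 * (1 - 4 * PowerSeries.X) = 1 := by
  have hD := one_sub_four_mul_derivative_centralBinomSeries
  apply PowerSeries.derivative.ext
  · have h4 : PowerSeries.derivative ℝ (4 : PowerSeries ℝ) = 0 := by
      rw [show (4 : PowerSeries ℝ) = PowerSeries.C (4 : ℝ) from (map_ofNat PowerSeries.C 4).symm]
      exact PowerSeries.derivative_C
    rw [Derivation.leibniz, Derivation.leibniz_pow]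
    simp [PowerSeries.derivative_X, h4]
    linear_combination (2 * centralBinomSeries) * hD
  · simp [centralBinomSeries]

/-- The first-order equation satisfied by `(1 - 4 s) ^ (-1 / 2)`, in terms of the Euler operator. -/
theorem two_mul_euler_centralBinomSeries :
    2 * (PowerSeries.X * PowerSeries.derivative ℝ centralBinomSeries)
      = centralBinomSeries ^ 3 - centralBinomSeries := by
  have hD := one_sub_four_mul_derivative_centralBinomSeries
  have hc := centralBinomSeries_sq_mul
  linear_combination (2 * PowerSeries.X * centralBinomSeries ^ 2) * hD
    - (2 * PowerSeries.X * PowerSeries.derivative ℝ centralBinomSeries) * hc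
    - centralBinomSeries * hc

/-- The coefficients of the power series `((1 + r) / 2) ^ (1 / 2)`, where `r = (1 - 4 s) ^ (1 / 2)`. -/
noncomputable def sqrtSeriesCoeff (l : ℕ) : ℝ :=
  -((Nat.centralBinom (2 * l) : ℝ) / 4 ^ l) / (4 * l - 1)

/-- The power series `((1 + r) / 2) ^ (1 / 2) r ^ (-b)`, where `r = (1 - 4 s) ^ (1 / 2)`. -/
noncomputable def sqrtSeries (b : ℕ) : PowerSeries ℝ :=
  PowerSeries.mk sqrtSeriesCoeff * centralBinomSeries ^ b

theorem sqrtSeriesCoeff_succ (l : ℕ) :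
    (2 * l + 2) * (2 * l + 1) * sqrtSeriesCoeff (l + 1)
      = (4 * l - 1) * (4 * l + 1) * sqrtSeriesCoeff l := by
  have h1 : (4 * (l : ℝ) - 1) ≠ 0 := by
    intro h
    have : (4 * (l : ℤ) - 1) = 0 := by exact_mod_cast h
    omega
  have h2 : (4 * ((l + 1 : ℕ) : ℝ) - 1) ≠ 0 := by
    push_cast
    have : (0 : ℝ) ≤ l := l.cast_nonneg
    linarith
  have e1 := Nat.succ_mul_centralBinom_succ (2 * l)
  have e2 := Nat.succ_mul_centralBinom_succ (2 * l + 1)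
  have e1' : ((2 * l + 1 : ℕ) : ℝ) * (Nat.centralBinom (2 * l + 1) : ℝ)
    = 2 * (2 * ((2 * l : ℕ) : ℝ) + 1) * (Nat.centralBinom (2 * l) : ℝ) := by exact_mod_cast e1
  have e2' : ((2 * l + 1 + 1 : ℕ) : ℝ) * (Nat.centralBinom (2 * (l + 1)) : ℝ)
    = 2 * (2 * ((2 * l + 1 : ℕ) : ℝ) + 1) * (Nat.centralBinom (2 * l + 1) : ℝ) := by
    exact_mod_cast e2
  push_cast at e1' e2' h2
  rw [show (4 * ((l : ℝ) + 1) - 1) = 4 * l + 3 by ring] at h2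
  have e3 : (2 * l + 2 : ℝ) * (2 * l + 1) * (Nat.centralBinom (2 * (l + 1)) : ℝ)
      = 4 * (4 * l + 3) * (4 * l + 1) * Nat.centralBinom (2 * l) := by
    linear_combination (2 * (l : ℝ) + 1) * e2' + 2 * (4 * (l : ℝ) + 3) * e1'
  unfold sqrtSeriesCoeff
  push_cast
  rw [pow_succ, show (4 * ((l : ℝ) + 1) - 1) = 4 * l + 3 by ring]
  generalize (Nat.centralBinom (2 * (l + 1)) : ℝ) = C' at *
  generalize (Nat.centralBinom (2 * l) : ℝ) = C at *
  have h5 : (2 * l + 2 : ℝ) * (2 * l + 1) * (-(C' / (4 ^ l * 4)) / (4 * l + 3))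
      = -((2 * l + 2 : ℝ) * (2 * l + 1) * C') / (4 ^ l * 4 * (4 * l + 3)) := by
    field_simp
  rw [h5, e3]
  field_simp

theorem sqrtSeries_add_two_mul (b : ℕ) :
    sqrtSeries (b + 2) * (1 - 4 * PowerSeries.X) = sqrtSeries b := by
  unfold sqrtSeries
  linear_combination (PowerSeries.mk sqrtSeriesCoeff * centralBinomSeries ^ b)
    * centralBinomSeries_sq_mul

theorem coeff_mul_one_sub_four_X (f : PowerSeries ℝ) (l : ℕ) :
    PowerSeries.coeff (l + 1) (f * (1 - 4 * PowerSeries.X))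
      = PowerSeries.coeff (l + 1) f - 4 * PowerSeries.coeff l f := by
  rw [show f * (1 - 4 * PowerSeries.X) = f - PowerSeries.C (4 : ℝ) * (f * PowerSeries.X) by
    rw [map_ofNat]; ring]
  rw [map_sub, PowerSeries.coeff_C_mul, PowerSeries.coeff_succ_mul_X]

theorem coeff_X_mul_derivative (f : PowerSeries ℝ) (l : ℕ) :
    PowerSeries.coeff l (PowerSeries.X * PowerSeries.derivative ℝ f)
      = l * PowerSeries.coeff l f := by
  rcases l with _ | l
  · simp
  · rw [PowerSeries.coeff_succ_X_mul, PowerSeries.coeff_derivative]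
    push_cast
    ring

theorem coeff_sqrtSeries_succ_succ (b l : ℕ) :
    PowerSeries.coeff (l + 1) (sqrtSeries (b + 2))
      = 4 * PowerSeries.coeff l (sqrtSeries (b + 2)) + PowerSeries.coeff (l + 1) (sqrtSeries b) := by
  have h := congrArg (PowerSeries.coeff (l + 1)) (sqrtSeries_add_two_mul b)
  rw [coeff_mul_one_sub_four_X] at h
  linear_combination h

/-- Comparing coefficients expresses `(4 l - 2) f_l` through earlier coefficients, and `4 l = 2` has
no integer solution, so there is no resonance. -/
theorem eq_zero_of_four_mul_euler_eq {f g : PowerSeries ℝ}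
    (h : 4 * (PowerSeries.X * PowerSeries.derivative ℝ f) = g * f)
    (hg : PowerSeries.constantCoeff g = 2) : f = 0 := by
  ext l
  induction l using Nat.strong_induction_on with
  | _ l ih =>
    have h1 := congrArg (PowerSeries.coeff l) h
    rw [show (4 : PowerSeries ℝ) = PowerSeries.C (4 : ℝ) from (map_ofNat PowerSeries.C 4).symm,
      PowerSeries.coeff_C_mul, coeff_X_mul_derivative, PowerSeries.coeff_mul,
      Finset.sum_eq_single (0, l)] at h1
    · rw [PowerSeries.coeff_zero_eq_constantCoeff_apply, hg] at h1
      have h2 : (4 * (l : ℝ) - 2) ≠ 0 := by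
        intro h
        have : (4 * (l : ℤ) - 2) = 0 := by exact_mod_cast h
        omega
      have h3 : (4 * (l : ℝ) - 2) * PowerSeries.coeff l f = 0 := by linear_combination h1
      simpa [h2] using h3
    · rintro ⟨p, q⟩ hpq hne
      rw [Finset.HasAntidiagonal.mem_antidiagonal] at hpq
      have hq : q < l := by
        rcases Nat.eq_zero_or_pos p with hp | hp
        · exact absurd (by simp_all) hne
        · simp only at hpq; omega
      simp [ih q hq]
    · simp

/-- With `s = 4 z^2`, the right side is the even part of `(1 - 4 z)^(-1/2)`, which explains the
formula. Formally, the difference of the two sides solves a homogeneous Euler equation with only the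
zero solution. -/
theorem sqrtSeries_one :
    sqrtSeries 1 = PowerSeries.mk fun l => (Nat.centralBinom (2 * l) : ℝ) / 4 ^ l := by
  set F0 : PowerSeries ℝ := PowerSeries.mk sqrtSeriesCoeff with hF0
  set F1 : PowerSeries ℝ := PowerSeries.mk fun l => (Nat.centralBinom (2 * l) : ℝ) / 4 ^ l with hF1
  have hcoeff (l : ℕ) : (Nat.centralBinom (2 * l) : ℝ) / 4 ^ l = (1 - 4 * l) * sqrtSeriesCoeff l := by
    have h1 : (4 * (l : ℝ) - 1) ≠ 0 := by
      intro h
      have : (4 * (l : ℤ) - 1) = 0 := by exact_mod_cast h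
      omega
    unfold sqrtSeriesCoeff
    field_simp
    ring
  have h4 : (4 : PowerSeries ℝ) = PowerSeries.C (4 : ℝ) := (map_ofNat PowerSeries.C 4).symm
  have h2 : (2 : PowerSeries ℝ) = PowerSeries.C (2 : ℝ) := (map_ofNat PowerSeries.C 2).symm
  have hS0 : 4 * (PowerSeries.X * PowerSeries.derivative ℝ F0) = F0 - F1 := by
    ext l
    rw [h4, PowerSeries.coeff_C_mul, coeff_X_mul_derivative, map_sub, hF0, hF1,
      PowerSeries.coeff_mk, PowerSeries.coeff_mk, hcoeff]
    ring
  -- The ratio recurrence `sqrtSeriesCoeff_succ` in differential form; with `hS0` it makes a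
  -- first-order system for `F0` and `F1`.
  have hS1 : (4 * (PowerSeries.X * PowerSeries.derivative ℝ F1) + F1) * (1 - 4 * PowerSeries.X)
      = 2 * F1 - F0 := by
    ext l
    rcases l with _ | l
    · simp [hF0, hF1, sqrtSeriesCoeff, map_ofNat]
      norm_num
    · rw [coeff_mul_one_sub_four_X, map_add, map_add, h4, PowerSeries.coeff_C_mul,
        PowerSeries.coeff_C_mul, coeff_X_mul_derivative, coeff_X_mul_derivative, map_sub, h2,
        PowerSeries.coeff_C_mul, hF0, hF1]
      simp only [PowerSeries.coeff_mk, hcoeff]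
      have := sqrtSeriesCoeff_succ l
      push_cast
      linear_combination (-4 : ℝ) * this
  have hc := centralBinomSeries_sq_mul
  have hE := two_mul_euler_centralBinomSeries
  have key : F0 * centralBinomSeries - F1 = 0 := by
    apply eq_zero_of_four_mul_euler_eq
      (g := 2 * centralBinomSeries ^ 2 + centralBinomSeries - 1)
    · rw [map_sub, Derivation.leibniz]
      simp only [smul_eq_mul]
      linear_combination centralBinomSeries * hS0 + 2 * F0 * hE - centralBinomSeries ^ 2 * hS1
        + (4 * (PowerSeries.X * PowerSeries.derivative ℝ F1) + F1) * hc
    · simp [centralBinomSeries, map_ofNat]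
  unfold sqrtSeries
  rw [pow_one]
  linear_combination key

/-- The case `b = 0` is `sqrtSeries_one` read on coefficients; each further factor `r^(-1)` enters
through the Leibniz rule. -/
theorem four_mul_euler_sqrtSeries (b : ℕ) :
    4 * (PowerSeries.X * PowerSeries.derivative ℝ (sqrtSeries b))
      = (1 - 2 * (b : PowerSeries ℝ)) * sqrtSeries b - sqrtSeries (b + 1)
        + 2 * (b : PowerSeries ℝ) * sqrtSeries (b + 2) := by
  have h0 : 4 * (PowerSeries.X * PowerSeries.derivative ℝ (sqrtSeries 0))
      = sqrtSeries 0 - sqrtSeries 1 := by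
    ext l
    rw [sqrtSeries_one, show (4 : PowerSeries ℝ) = PowerSeries.C (4 : ℝ) from
      (map_ofNat PowerSeries.C 4).symm, PowerSeries.coeff_C_mul, coeff_X_mul_derivative, map_sub]
    have h1 : (4 * (l : ℝ) - 1) ≠ 0 := by
      intro h
      have : (4 * (l : ℤ) - 1) = 0 := by exact_mod_cast h
      omega
    simp only [sqrtSeries, pow_zero, mul_one, PowerSeries.coeff_mk, sqrtSeriesCoeff]
    field_simp
    ring
  have hE := two_mul_euler_centralBinomSeries
  induction b with
  | zero => simp [h0]
  | succ b ih =>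
    have hs (k : ℕ) : sqrtSeries (k + 1) = sqrtSeries k * centralBinomSeries := by
      unfold sqrtSeries
      ring
    have h1 := hs b
    have h2 := hs (b + 1)
    have h3 := hs (b + 2)
    rw [show b + 1 + 1 = b + 2 by ring] at *
    rw [show b + 2 + 1 = b + 3 by ring] at *
    rw [show b + 1 + 2 = b + 3 by ring, h1, Derivation.leibniz, h3, h2, h1]
    rw [h2, h1] at ih
    simp only [smul_eq_mul]
    push_cast
    linear_combination centralBinomSeries * ih + 2 * sqrtSeries b * hE

theorem coeff_sqrtSeries_euler (b l : ℕ) :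
    (4 * l + 2 * b - 1) * PowerSeries.coeff l (sqrtSeries b)
      = 2 * b * PowerSeries.coeff l (sqrtSeries (b + 2))
        - PowerSeries.coeff l (sqrtSeries (b + 1)) := by
  have h := congrArg (PowerSeries.coeff l) (four_mul_euler_sqrtSeries b)
  rw [show (4 : PowerSeries ℝ) = PowerSeries.C (4 : ℝ) from (map_ofNat PowerSeries.C 4).symm,
    show (1 - 2 * (b : PowerSeries ℝ)) = PowerSeries.C (1 - 2 * (b : ℝ)) by simp [map_ofNat],
    show (2 * (b : PowerSeries ℝ)) = PowerSeries.C (2 * (b : ℝ)) by simp [map_ofNat],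
    map_add, map_sub, PowerSeries.coeff_C_mul, PowerSeries.coeff_C_mul, PowerSeries.coeff_C_mul,
    coeff_X_mul_derivative] at h
  linear_combination h

/-- The second-order differential equation satisfied by `((1 + r) / 2) ^ (1 / 2) r ^ (-b)`, in terms
of coefficients. -/
theorem coeff_sqrtSeries_three_term (b l : ℕ) :
    4 * b * (b - 1) * PowerSeries.coeff l (sqrtSeries (b + 2))
      = (2 * b - 1 + 4 * l) * (2 * b + 1 + 4 * l) * PowerSeries.coeff l (sqrtSeries b)
        - (2 * l + 2) * (2 * l + 1) * PowerSeries.coeff (l + 1) (sqrtSeries b) := by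
  have a1 := coeff_sqrtSeries_euler b l
  have a2 := coeff_sqrtSeries_euler b (l + 1)
  have a3 := coeff_sqrtSeries_euler (b + 1) l
  have a4 := coeff_sqrtSeries_euler (b + 1) (l + 1)
  have c1 := coeff_sqrtSeries_succ_succ b l
  have c2 := coeff_sqrtSeries_succ_succ (b + 1) l
  rw [show b + 1 + 1 = b + 2 by ring, show b + 1 + 2 = b + 3 by ring] at *
  push_cast at *
  generalize PowerSeries.coeff l (sqrtSeries (b + 3)) = t at *
  generalize PowerSeries.coeff (l + 1) (sqrtSeries (b + 3)) = T at *
  generalize PowerSeries.coeff l (sqrtSeries (b + 2)) = x at *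
  generalize PowerSeries.coeff (l + 1) (sqrtSeries (b + 2)) = X at *
  generalize PowerSeries.coeff l (sqrtSeries (b + 1)) = y at *
  generalize PowerSeries.coeff (l + 1) (sqrtSeries (b + 1)) = Y at *
  generalize PowerSeries.coeff l (sqrtSeries b) = z at *
  generalize PowerSeries.coeff (l + 1) (sqrtSeries b) = Z at *
  -- The combination is chosen to eliminate both coefficients of `F_(b+3)`.
  have d : (4 * l + 3) * Y + X - 4 * x - 4 * (4 * l + 2 * b + 1) * y = 0 := by
    linear_combination a4 - 4 * a3 + (2 * b + 2 : ℝ) * c2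
  have hY : Y = 2 * b * X - (4 * l + 2 * b + 3) * Z := by linear_combination a2
  have hy : y = 2 * b * x - (4 * l + 2 * b - 1) * z := by linear_combination a1
  have hX : X = 4 * x + Z := c1
  subst hY hy hX
  linear_combination (-1 / 4 : ℝ) * d

/-! ### Moment products, convolution and the iterated recurrence -/

/-- The product `x (x + 2) ⋯ (x + 2 (q - 1))`, which for `x = d` is the `q`-th moment of the `χ²`
distribution with `d` degrees of freedom. -/
noncomputable def chiMoment (x : ℝ) (q : ℕ) : ℝ := ∏ t ∈ Finset.range q, (x + 2 * t)

@[simp] theorem chiMoment_zero (x : ℝ) : chiMoment x 0 = 1 := by simp [chiMoment]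

theorem chiMoment_succ (x : ℝ) (q : ℕ) : chiMoment x (q + 1) = chiMoment x q * (x + 2 * q) := by
  rw [chiMoment, Finset.prod_range_succ, chiMoment]

theorem chiMoment_add (x : ℝ) (p q : ℕ) :
    chiMoment x (p + q) = chiMoment x p * chiMoment (x + 2 * p) q := by
  induction q with
  | zero => simp
  | succ q ih =>
    rw [← add_assoc, chiMoment_succ, ih, chiMoment_succ]
    push_cast
    ring

/-- The coefficients of `(1 - 4 s) ^ (-i - 1 / 2)`. -/
noncomputable def oddPowCoeff (i p : ℕ) : ℝ :=
  ((2 * i + 2 * p).factorial : ℝ) * i.factorial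
    / ((2 * i).factorial * (i + p).factorial * p.factorial)

theorem oddPowCoeff_succ (i p : ℕ) :
    oddPowCoeff (i + 1) (p + 1) - 4 * oddPowCoeff (i + 1) p = oddPowCoeff i (p + 1) := by
  unfold oddPowCoeff
  rw [show 2 * (i + 1) + 2 * (p + 1) = 2 * i + 2 * p + 1 + 1 + 1 + 1 by ring,
    show 2 * (i + 1) + 2 * p = 2 * i + 2 * p + 1 + 1 by ring,
    show 2 * i + 2 * (p + 1) = 2 * i + 2 * p + 1 + 1 by ring,
    show 2 * (i + 1) = 2 * i + 1 + 1 by ring, show i + 1 + (p + 1) = i + p + 1 + 1 by ring,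
    show i + 1 + p = i + p + 1 by ring, show i + (p + 1) = i + p + 1 by ring]
  simp only [Nat.factorial_succ]
  push_cast
  field_simp
  ring

theorem centralBinomSeries_odd_pow (i : ℕ) :
    centralBinomSeries ^ (2 * i + 1) = PowerSeries.mk (oddPowCoeff i) := by
  induction i with
  | zero =>
    ext p
    simp only [centralBinomSeries, mul_zero, zero_add, pow_one, PowerSeries.coeff_mk, oddPowCoeff]
    rw [Nat.centralBinom_eq_two_mul_choose, Nat.cast_choose ℝ (by omega : p ≤ 2 * p),
      show 2 * p - p = p by omega]
    simp
  | succ i ih =>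
    have h : PowerSeries.mk (oddPowCoeff (i + 1)) * (1 - 4 * PowerSeries.X)
        = PowerSeries.mk (oddPowCoeff i) := by
      ext p
      rcases p with _ | p
      · simp [oddPowCoeff]
        field_simp
      · rw [coeff_mul_one_sub_four_X]
        simp only [PowerSeries.coeff_mk]
        exact oddPowCoeff_succ i p
    rw [← ih] at h
    linear_combination centralBinomSeries ^ 2 * (-h)
      + PowerSeries.mk (oddPowCoeff (i + 1)) * centralBinomSeries_sq_mul

/-- The factorisation `F_(b+1+2i) = F_b r^(-2i-1)`, read on coefficients: this convolution is the
passage from odd to even size. -/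
theorem coeff_sqrtSeries_add_odd (b i M : ℕ) :
    PowerSeries.coeff M (sqrtSeries (b + 1 + 2 * i))
      = ∑ j ∈ Finset.range (M + 1),
          PowerSeries.coeff j (sqrtSeries b) * oddPowCoeff i (M - j) := by
  have h : sqrtSeries (b + 1 + 2 * i) = sqrtSeries b * centralBinomSeries ^ (2 * i + 1) := by
    unfold sqrtSeries
    ring
  rw [h, centralBinomSeries_odd_pow, PowerSeries.coeff_mul,
    Finset.Nat.sum_antidiagonal_eq_sum_range_succ
      (fun p q => PowerSeries.coeff p (sqrtSeries b) *
        PowerSeries.coeff q (PowerSeries.mk (oddPowCoeff i)))]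
  simp

/-- The initial condition: it makes size one fit the closed form. -/
theorem coeff_sqrtSeries_one (l : ℕ) :
    PowerSeries.coeff l (sqrtSeries 1) * (2 * l).factorial = chiMoment 1 (2 * l) := by
  rw [sqrtSeries_one, PowerSeries.coeff_mk]
  have h (q : ℕ) : chiMoment 1 q * (2 ^ q * q.factorial) = (2 * q).factorial := by
    induction q with
    | zero => simp
    | succ q ih =>
      rw [chiMoment_succ, show 2 * (q + 1) = 2 * q + 1 + 1 by ring, Nat.factorial_succ,
        Nat.factorial_succ, Nat.factorial_succ, pow_succ]
      push_cast
      rw [← ih]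
      ring
  have h' := h (2 * l)
  rw [Nat.centralBinom_eq_two_mul_choose, Nat.cast_choose ℝ (by omega : 2 * l ≤ 2 * (2 * l)),
    show 2 * (2 * l) - 2 * l = 2 * l by omega, ← h', pow_mul]
  have : ((2 : ℝ) ^ 2) ^ l = 4 ^ l := by norm_num
  rw [this]
  field_simp

theorem sum_alternating_choose_succ (T : ℕ → ℝ) (j : ℕ) :
    ∑ p ∈ Finset.range (j + 2), (-1) ^ p * ((j + 1).choose p : ℝ) * T p
      = ∑ p ∈ Finset.range (j + 1), (-1) ^ p * (j.choose p : ℝ) * (T p - T (p + 1)) := by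
  have h : ∑ p ∈ Finset.range (j + 1), (-1) ^ p * (j.choose p : ℝ) * T p
      = ∑ p ∈ Finset.range (j + 1), (-1) ^ (p + 1) * (j.choose (p + 1) : ℝ) * T (p + 1)
        + T 0 := by
    have h1 := Finset.sum_range_succ (fun p => (-1) ^ p * (j.choose p : ℝ) * T p) (j + 1)
    rw [Finset.sum_range_succ'] at h1
    simpa using h1.symm
  simp only [mul_sub, Finset.sum_sub_distrib]
  rw [h, Finset.sum_range_succ']
  simp only [Nat.choose_succ_succ, Nat.cast_add, mul_add, add_mul, Finset.sum_add_distrib, pow_succ]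
  simp
  ring

/-- Iterating the three-term recurrence for the coefficients of `sqrtSeries b`. -/
theorem chiMoment_mul_coeff_sqrtSeries (n j : ℕ) : ∀ l : ℕ,
    chiMoment (2 * n + 2) (2 * j) * ((2 * l).factorial *
        PowerSeries.coeff l (sqrtSeries (n + 2 + 2 * j)))
      = ∑ p ∈ Finset.range (j + 1), (-1) ^ p * (j.choose p : ℝ) *
          (chiMoment (2 * n + 3 + 4 * (l + p : ℕ)) (2 * (j - p)) *
            ((2 * (l + p)).factorial * PowerSeries.coeff (l + p) (sqrtSeries (n + 2)))) := by
  induction j with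
  | zero => intro l; simp
  | succ j ih =>
    intro l
    have h3 := coeff_sqrtSeries_three_term (n + 2 + 2 * j) l
    have e1 := ih l
    have e2 := ih (l + 1)
    have hf : ((2 * (l + 1)).factorial : ℝ) = (2 * l + 2) * (2 * l + 1) * (2 * l).factorial := by
      rw [show 2 * (l + 1) = 2 * l + 1 + 1 by ring, Nat.factorial_succ, Nat.factorial_succ]
      push_cast
      ring
    rw [hf] at e2
    -- At `b = n + 2 + 2 j` the factor `4 b (b - 1)` of the three-term recurrence equals
    -- `(2n+2+4j)(2n+4+4j)`, the two new factors of the moment product.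
    have hL : chiMoment (2 * n + 2) (2 * (j + 1)) * ((2 * l).factorial *
          PowerSeries.coeff l (sqrtSeries (n + 2 + 2 * (j + 1))))
        = (2 * n + 3 + 4 * j + 4 * l) * (2 * n + 5 + 4 * j + 4 * l) *
            (chiMoment (2 * n + 2) (2 * j) * ((2 * l).factorial *
              PowerSeries.coeff l (sqrtSeries (n + 2 + 2 * j))))
          - chiMoment (2 * n + 2) (2 * j) * ((2 * l + 2) * (2 * l + 1) * (2 * l).factorial *
              PowerSeries.coeff (l + 1) (sqrtSeries (n + 2 + 2 * j))) := by
      rw [show 2 * (j + 1) = 2 * j + 1 + 1 by ring, chiMoment_succ, chiMoment_succ,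
        show n + 2 + (2 * j + 1 + 1) = n + 2 + 2 * j + 2 by ring]
      push_cast at h3 ⊢
      linear_combination chiMoment (2 * n + 2) (2 * j) * ((2 * l).factorial : ℝ) * h3
    rw [hL, e1]
    set g : ℕ → ℝ := fun i => (2 * i).factorial * PowerSeries.coeff i (sqrtSeries (n + 2)) with hg
    -- The two factors added to the moment product starting at `2n+3+4(l+p)` do not depend on `p`,
    -- so they come out of the sum.
    have hA : ∑ p ∈ Finset.range (j + 1), (-1) ^ p * (j.choose p : ℝ) *
          (chiMoment (2 * n + 3 + 4 * (l + p : ℕ)) (2 * (j + 1 - p)) * g (l + p))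
        = (2 * n + 3 + 4 * j + 4 * l) * (2 * n + 5 + 4 * j + 4 * l) *
          ∑ p ∈ Finset.range (j + 1), (-1) ^ p * (j.choose p : ℝ) *
          (chiMoment (2 * n + 3 + 4 * (l + p : ℕ)) (2 * (j - p)) * g (l + p)) := by
      rw [Finset.mul_sum]
      refine Finset.sum_congr rfl fun p hp => ?_
      have hp' : p ≤ j := Nat.lt_succ_iff.1 (Finset.mem_range.1 hp)
      obtain ⟨d, rfl⟩ := Nat.exists_eq_add_of_le hp'
      rw [show 2 * (p + d + 1 - p) = 2 * d + 1 + 1 by omega, show p + d - p = d by omega,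
        chiMoment_succ, chiMoment_succ]
      push_cast
      ring
    rw [← hA, sum_alternating_choose_succ
      (fun p => chiMoment (2 * n + 3 + 4 * (l + p : ℕ)) (2 * (j + 1 - p)) * g (l + p))]
    simp only [mul_sub, Finset.sum_sub_distrib]
    congr 1
    rw [e2]
    refine Finset.sum_congr rfl fun p _ => ?_
    rw [show l + (p + 1) = l + 1 + p by ring, show j + 1 - (p + 1) = j - p by omega]

/-- Newton's formula: the inner sum is the `j`-th forward difference of `Y` at `0`, and the outer
sum rebuilds the shift by `M`. -/
theorem sum_choose_mul_sum_alternating (Y : ℕ → ℝ) (M : ℕ) :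
    ∑ j ∈ Finset.range (M + 1), (M.choose j : ℝ) *
      ∑ p ∈ Finset.range (j + 1), (-1) ^ p * (j.choose p : ℝ) * Y (j - p) = Y M := by
  have h := shift_eq_sum_fwdDiff_iter 1 Y M 0
  simp only [smul_eq_mul, mul_one, zero_add, nsmul_eq_mul] at h
  rw [h]
  refine Finset.sum_congr rfl fun j _ => ?_
  congr 1
  rw [fwdDiff_iter_eq_sum_shift, ← Finset.sum_range_reflect]
  refine Finset.sum_congr rfl fun p hp => ?_
  have hp' : p ≤ j := Nat.lt_succ_iff.1 (Finset.mem_range.1 hp)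
  obtain ⟨d, rfl⟩ := Nat.exists_eq_add_of_le hp'
  rw [show p + d + 1 - 1 - p = d by omega, show p + d - d = p by omega]
  rw [show p + d - p = d by omega, ← Nat.choose_symm_add]
  simp

/-! ### Solving the recursion -/

/-- The recursion satisfied by the even joint moments
`J N m i = E[(det M_N) ^ (2 m - 2 i) (det M_{N - 1}) ^ (2 i)]` of consecutive leading minors of a
GOE matrix. -/
structure IsDetMomentRecursion (J : ℕ → ℕ → ℕ → ℝ) : Prop where
  one : ∀ i M, J 1 (i + M) i = (2 * M).factorial / M.factorial
  succ : ∀ N i M, J (N + 2) (i + M) i = ∑ j ∈ Finset.range (M + 1),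
    ((2 * M).choose (2 * j) : ℝ) * ((2 * (M - j)).factorial / (M - j).factorial)
      * chiMoment (N + 1 : ℕ) (2 * j) * J (N + 1) (i + M) j

theorem choose_mul_choose_mul_factorial (i j d : ℕ) :
    ((2 * (i + (j + d))).choose (2 * i) : ℝ) * ((2 * (j + d)).choose (2 * j) : ℝ)
        * (2 * d).factorial
      = (2 * (i + (j + d))).choose (2 * j) * ((2 * (i + d)).factorial / (2 * i).factorial) := by
  rw [show 2 * (i + (j + d)) = 2 * i + 2 * (j + d) by ring, Nat.cast_add_choose,
    show 2 * i + 2 * (j + d) = 2 * j + 2 * (i + d) by ring, Nat.cast_add_choose,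
    show 2 * (j + d) = 2 * j + 2 * d by ring, Nat.cast_add_choose]
  field_simp

section recursion

variable {J : ℕ → ℕ → ℕ → ℝ}

/-- Once the binomials are rearranged, the recursion agrees term by term with the convolution
`coeff_sqrtSeries_add_odd`. -/
theorem IsDetMomentRecursion.even_of_odd (hJ : IsDetMomentRecursion J) {n m : ℕ} {A : ℝ}
    (h : ∀ i M, i + M = m → J (2 * n + 1) m i * ((m.choose i : ℝ) * i.factorial)⁻¹ *
      ((2 * m).choose (2 * i) * chiMoment (2 * n + 1 : ℕ) (2 * i))
        = A * PowerSeries.coeff i (sqrtSeries (n + 1)))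
    {i M : ℕ} (hm : i + M = m) :
    ((2 * m).choose (2 * i) : ℝ) * J (2 * n + 2) m i
      = A * (m.factorial / i.factorial) * PowerSeries.coeff M (sqrtSeries (n + 2 + 2 * i)) := by
  subst hm
  rw [hJ.succ, show n + 2 + 2 * i = n + 1 + 1 + 2 * i by ring,
    coeff_sqrtSeries_add_odd, Finset.mul_sum, Finset.mul_sum]
  refine Finset.sum_congr rfl fun j hj => ?_
  obtain ⟨d, rfl⟩ := Nat.exists_eq_add_of_le (Nat.lt_succ_iff.1 (Finset.mem_range.1 hj))
  rw [show j + d - j = d by omega]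
  have hj := h j (i + d) (by ring)
  have hc := choose_mul_choose_mul_factorial i j d
  have hpos : (0 : ℝ) < (2 * (i + (j + d))).choose (2 * j) := by
    exact_mod_cast Nat.choose_pos (by omega)
  have hch : ((i + (j + d)).choose j : ℝ) = (i + (j + d)).factorial /
      (j.factorial * (i + d).factorial) := by
    rw [show i + (j + d) = j + (i + d) by ring, Nat.cast_add_choose]
  rw [hch] at hj
  have hJ' : chiMoment (2 * n + 1 : ℕ) (2 * j) * J (2 * n + 1) (i + (j + d)) j
      = A * PowerSeries.coeff j (sqrtSeries (n + 1)) * ((i + (j + d)).factorial / (i + d).factorial)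
        / (2 * (i + (j + d))).choose (2 * j) := by
    rw [← hj]
    field_simp
  calc _ = ((2 * (i + (j + d))).choose (2 * i) * (2 * (j + d)).choose (2 * j)
        * (2 * d).factorial) / d.factorial
        * (chiMoment (2 * n + 1 : ℕ) (2 * j) * J (2 * n + 1) (i + (j + d)) j) := by ring
    _ = _ := by
      rw [hc, hJ', oddPowCoeff, show 2 * i + 2 * d = 2 * (i + d) by ring]
      field_simp

/-- The iterated recurrence turns the `j`-th term into an alternating sum, and binomial inversion
collapses the double sum to a single value `Y M`. -/
theorem IsDetMomentRecursion.odd_of_even (hJ : IsDetMomentRecursion J) {n m : ℕ} {A : ℝ}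
    (h : ∀ i M, i + M = m → ((2 * m).choose (2 * i) : ℝ) * J (2 * n + 2) m i
      = A * (m.factorial / i.factorial) * PowerSeries.coeff M (sqrtSeries (n + 2 + 2 * i)))
    {i M : ℕ} (hm : i + M = m) :
    J (2 * (n + 1) + 1) m i * ((m.choose i : ℝ) * i.factorial)⁻¹ *
      ((2 * m).choose (2 * i) * chiMoment (2 * (n + 1) + 1 : ℕ) (2 * i))
        = A * chiMoment (2 * n + 3) (2 * m) * PowerSeries.coeff i (sqrtSeries (n + 1 + 1)) := by
  subst hm
  -- Indexed downwards from `i + M`, so that coefficient `i + d + p` sits at `j - p`, as the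
  -- inversion requires.
  set Y : ℕ → ℝ := fun t => chiMoment (2 * n + 3 + 4 * (i + M - t : ℕ)) (2 * t) *
    ((2 * (i + M - t)).factorial * PowerSeries.coeff (i + M - t) (sqrtSeries (n + 2))) with hY
  have key : ((2 * (i + M)).choose (2 * i) : ℝ) * J (2 * (n + 1) + 1) (i + M) i
      = A * (i + M).factorial / ((2 * i).factorial * M.factorial) * Y M := by
    rw [← sum_choose_mul_sum_alternating Y M, show 2 * (n + 1) + 1 = 2 * n + 1 + 2 by ring,
      hJ.succ, Finset.mul_sum, Finset.mul_sum]
    refine Finset.sum_congr rfl fun j hj => ?_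
    obtain ⟨d, rfl⟩ := Nat.exists_eq_add_of_le (Nat.lt_succ_iff.1 (Finset.mem_range.1 hj))
    rw [show j + d - j = d by omega]
    have hj := h j (i + d) (by ring)
    have hc := choose_mul_choose_mul_factorial i j d
    have hpos : (0 : ℝ) < (2 * (i + (j + d))).choose (2 * j) := by
      exact_mod_cast Nat.choose_pos (by omega)
    have hsum := chiMoment_mul_coeff_sqrtSeries n j (i + d)
    have hsum' : ∑ p ∈ Finset.range (j + 1), (-1) ^ p * (j.choose p : ℝ) * Y (j - p)
        = chiMoment (2 * n + 2) (2 * j) * ((2 * (i + d)).factorial *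
          PowerSeries.coeff (i + d) (sqrtSeries (n + 2 + 2 * j))) := by
      rw [hsum]
      refine Finset.sum_congr rfl fun p hp => ?_
      have hp' : p ≤ j := Nat.lt_succ_iff.1 (Finset.mem_range.1 hp)
      simp only [hY]
      rw [show i + (j + d) - (j - p) = i + d + p by omega]
    have hJ' : J (2 * n + 2) (i + (j + d)) j = A * ((i + (j + d)).factorial / j.factorial) *
        PowerSeries.coeff (i + d) (sqrtSeries (n + 2 + 2 * j))
        / (2 * (i + (j + d))).choose (2 * j) := by
      rw [← hj]
      field_simp
    rw [hsum', Nat.cast_add_choose]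
    calc _ = ((2 * (i + (j + d))).choose (2 * i) * (2 * (j + d)).choose (2 * j)
          * (2 * d).factorial) / d.factorial
          * (chiMoment (2 * n + 2 : ℕ) (2 * j) * J (2 * n + 2) (i + (j + d)) j) := by ring
      _ = _ := by
        rw [hc, hJ']
        push_cast
        field_simp
  have hYM : Y M = chiMoment (2 * n + 3 + 4 * (i : ℕ)) (2 * M) *
      ((2 * i).factorial * PowerSeries.coeff i (sqrtSeries (n + 2))) := by
    simp only [hY]
    rw [show i + M - M = i by omega]
  rw [hYM] at key
  -- The normalising product of length `2 i` and the product of length `2 M` in `Y M` join into the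
  -- new factor of `A`.
  have hadd := chiMoment_add (2 * n + 3) (2 * i) (2 * M)
  rw [show 2 * i + 2 * M = 2 * (i + M) by ring,
    show (2 * n + 3 : ℝ) + 2 * (2 * i : ℕ) = 2 * n + 3 + 4 * (i : ℕ) by push_cast; ring] at hadd
  rw [hadd, show ((2 * (n + 1) + 1 : ℕ) : ℝ) = 2 * n + 3 by push_cast; ring, Nat.cast_add_choose]
  calc _ = (((2 * (i + M)).choose (2 * i) : ℝ) * J (2 * (n + 1) + 1) (i + M) i) *
        (M.factorial / (i + M).factorial) * chiMoment (2 * n + 3) (2 * i) := by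
        field_simp
    _ = _ := by
      rw [key]
      field_simp

/-- The even moments of the determinant of a GOE matrix of odd size, from the recursion. -/
theorem IsDetMomentRecursion.odd_eq (hJ : IsDetMomentRecursion J) (n m : ℕ) :
    J (2 * n + 1) m 0
      = (2 * m).factorial / m.factorial * ∏ t ∈ Finset.range n, chiMoment (2 * t + 3) (2 * m) := by
  have main : ∀ i M, i + M = m → J (2 * n + 1) m i * ((m.choose i : ℝ) * i.factorial)⁻¹ *
      ((2 * m).choose (2 * i) * chiMoment (2 * n + 1 : ℕ) (2 * i))
        = ((2 * m).factorial / m.factorial * ∏ t ∈ Finset.range n, chiMoment (2 * t + 3) (2 * m))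
          * PowerSeries.coeff i (sqrtSeries (n + 1)) := by
    induction n with
    | zero =>
      rintro i M rfl
      have h1 := coeff_sqrtSeries_one i
      simp only [mul_zero, zero_add, Finset.range_zero, Finset.prod_empty, mul_one, Nat.cast_one]
      rw [hJ.one, ← h1, show 2 * (i + M) = 2 * i + 2 * M by ring, Nat.cast_add_choose,
        Nat.cast_add_choose]
      field_simp
    | succ n ih =>
      rw [Finset.prod_range_succ, ← mul_assoc]
      exact fun i M hm => hJ.odd_of_even (fun i M hm => hJ.even_of_odd ih hm) hm
  have h := main 0 m (zero_add m)
  have h0 : PowerSeries.coeff 0 (sqrtSeries (n + 1)) = 1 := by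
    simp [sqrtSeries, centralBinomSeries, sqrtSeriesCoeff]
  simpa [h0] using h

end recursion

/-! ### Moments of the Gaussian and `χ²` laws -/

theorem two_pow_mul_Gamma_add {d : ℝ} (hd : 0 < d) (k : ℕ) :
    2 ^ k * Real.Gamma (d / 2 + k) = chiMoment d k * Real.Gamma (d / 2) := by
  induction k with
  | zero => simp
  | succ k ih =>
    rw [chiMoment_succ, Nat.cast_add, Nat.cast_one, ← add_assoc,
      Real.Gamma_add_one (by positivity), pow_succ]
    linear_combination (d + 2 * k) * ih

theorem chiMoment_one_eq (q : ℕ) :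
    chiMoment 1 q = (2 * q).factorial / (2 ^ q * q.factorial) := by
  rw [eq_div_iff (by positivity)]
  induction q with
  | zero => simp
  | succ q ih =>
    rw [chiMoment_succ, show 2 * (q + 1) = 2 * q + 1 + 1 by ring, Nat.factorial_succ,
      Nat.factorial_succ, Nat.factorial_succ, pow_succ]
    push_cast
    rw [← ih]
    ring

/-- The Vandermonde identity for the products `chiMoment`. -/
theorem chiMoment_vandermonde (x y : ℝ) (q : ℕ) :
    chiMoment (x + y) q = ∑ ij ∈ Finset.HasAntidiagonal.antidiagonal q,
      (q.choose ij.1 : ℝ) * (chiMoment x ij.1 * chiMoment y ij.2) := by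
  induction q with
  | zero => simp
  | succ q ih =>
    rw [Finset.sum_antidiagonal_choose_succ_mul (fun i j => chiMoment x i * chiMoment y j),
      chiMoment_succ, ih, Finset.sum_mul, ← Finset.sum_add_distrib]
    refine Finset.sum_congr rfl fun ij hij => ?_
    have h : ij.1 + ij.2 = q := Finset.HasAntidiagonal.mem_antidiagonal.1 hij
    have hs : (q.choose ij.2 : ℝ) = q.choose ij.1 := by
      rw [← h, Nat.choose_symm_add]
    have hq : (q : ℝ) = ij.1 + ij.2 := by rw [← h]; push_cast; ring
    rw [hs, chiMoment_succ, chiMoment_succ, hq]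
    ring

theorem integral_even_pow_gaussianReal (q : ℕ) :
    ∫ x, x ^ (2 * q) ∂(gaussianReal 0 1) = chiMoment 1 q := by
  rw [integral_gaussianReal_eq_integral_smul one_ne_zero]
  have h1 : ∀ x : ℝ, gaussianPDFReal 0 1 x • x ^ (2 * q)
      = (√(2 * Real.pi))⁻¹ * (fun y : ℝ => y ^ ((2 * q : ℕ) : ℝ) *
        Real.exp (-(1 / 2) * y ^ (2 : ℝ))) |x| := by
    intro x
    simp only [gaussianPDFReal, smul_eq_mul, sub_zero, NNReal.coe_one, mul_one]
    rw [Real.rpow_natCast, pow_mul, pow_mul, sq_abs, Real.rpow_two, sq_abs,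
      show -x ^ 2 / 2 = -(1 / 2) * x ^ 2 by ring]
    ring
  simp_rw [h1]
  rw [integral_const_mul, integral_comp_abs
    (f := fun y : ℝ => y ^ ((2 * q : ℕ) : ℝ) * Real.exp (-(1 / 2) * y ^ (2 : ℝ))),
    integral_rpow_mul_exp_neg_mul_rpow (by norm_num)
      (by have : (0 : ℝ) ≤ ((2 * q : ℕ) : ℝ) := Nat.cast_nonneg _
          linarith) (by norm_num)]
  have hG := two_pow_mul_Gamma_add one_pos q
  rw [Real.Gamma_one_half_eq] at hG
  have hpow : (1 / 2 : ℝ) ^ (-(((2 * q : ℕ) : ℝ) + 1) / 2) = 2 ^ q * √2 := by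
    rw [one_div, Real.inv_rpow (by norm_num), ← Real.rpow_neg (by norm_num),
      show -(-(((2 * q : ℕ) : ℝ) + 1) / 2) = (q : ℝ) + 1 / 2 by push_cast; ring,
      Real.rpow_add (by norm_num), Real.rpow_natCast, Real.sqrt_eq_rpow]
  rw [hpow, show (((2 * q : ℕ) : ℝ) + 1) / 2 = 1 / 2 + q by push_cast; ring,
    Real.sqrt_mul (by norm_num)]
  generalize Real.Gamma (1 / 2 + q) = G at *
  have h2 : √2 ≠ 0 := by positivity
  have hpi : √Real.pi ≠ 0 := by positivity
  field_simp
  linear_combination hG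

theorem integral_odd_pow_gaussianReal (v : NNReal) {k : ℕ} (hk : Odd k) :
    ∫ x, x ^ k ∂(gaussianReal 0 v) = 0 := by
  have h : ∫ x, x ^ k ∂(gaussianReal 0 v) = ∫ x, (-x) ^ k ∂(gaussianReal 0 v) := by
    conv_lhs => rw [show gaussianReal 0 v = (gaussianReal 0 v).map (fun x => -x) by
      rw [gaussianReal_map_neg, neg_zero]]
    rw [integral_map (by fun_prop) (by fun_prop)]
  simp_rw [hk.neg_pow, integral_neg] at h
  linarith

theorem integral_even_pow_gaussianReal_two (q : ℕ) :
    ∫ x, x ^ (2 * q) ∂(gaussianReal 0 2) = (2 * q).factorial / q.factorial := by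
  have h : gaussianReal 0 2 = (gaussianReal 0 1).map (fun x => √2 * x) := by
    rw [gaussianReal_map_const_mul, mul_zero]
    congr 1
    ext
    simp
  rw [h, integral_map (by fun_prop) (by fun_prop)]
  simp_rw [mul_pow, integral_const_mul, integral_even_pow_gaussianReal, chiMoment_one_eq]
  rw [pow_mul, Real.sq_sqrt (by norm_num)]
  field_simp

/-- A factor `x^k` only shifts the shape parameter, so every moment reduces to the total mass of
another Gamma law. -/
theorem pow_mul_gammaPDFReal {a r : ℝ} (ha : 0 < a) (hr : 0 < r) (k : ℕ) {x : ℝ} (hx : x ≠ 0) :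
    x ^ k * gammaPDFReal a r x
      = Real.Gamma (a + k) / (Real.Gamma a * r ^ k) * gammaPDFReal (a + k) r x := by
  unfold gammaPDFReal
  split_ifs with h
  · have hx' : 0 < x := lt_of_le_of_ne h hx.symm
    have h1 := (Real.Gamma_pos_of_pos ha).ne'
    have h2 := (Real.Gamma_pos_of_pos (by positivity : 0 < a + k)).ne'
    rw [show a + k - 1 = (a - 1) + k by ring, Real.rpow_add hx', Real.rpow_add hr,
      Real.rpow_natCast, Real.rpow_natCast]
    field_simp
  · simp

theorem integrable_gammaPDFReal {a r : ℝ} (ha : 0 < a) (hr : 0 < r) :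
    Integrable (gammaPDFReal a r) := by
  refine ⟨(measurable_gammaPDFReal a r).aestronglyMeasurable, ?_⟩
  rw [hasFiniteIntegral_iff_ofReal (ae_of_all _ (gammaPDFReal_nonneg ha hr))]
  have := lintegral_gammaPDF_eq_one ha hr
  unfold gammaPDF at this
  simp [this]

theorem integral_gammaPDFReal {a r : ℝ} (ha : 0 < a) (hr : 0 < r) :
    ∫ x, gammaPDFReal a r x = 1 := by
  rw [integral_eq_lintegral_of_nonneg_ae (ae_of_all _ (gammaPDFReal_nonneg ha hr))
    (measurable_gammaPDFReal a r).aestronglyMeasurable]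
  have := lintegral_gammaPDF_eq_one ha hr
  unfold gammaPDF at this
  simp [this]

theorem pow_mul_gammaPDFReal_ae {a r : ℝ} (ha : 0 < a) (hr : 0 < r) (k : ℕ) :
    (fun x => (gammaPDF a r x).toReal • x ^ k) =ᵐ[volume] fun x =>
      Real.Gamma (a + k) / (Real.Gamma a * r ^ k) * gammaPDFReal (a + k) r x := by
  have h0 : ∀ᵐ x : ℝ, x ≠ 0 := by simp [ae_iff]
  filter_upwards [h0] with x hx
  rw [← pow_mul_gammaPDFReal ha hr k hx, gammaPDF,
    ENNReal.toReal_ofReal (gammaPDFReal_nonneg ha hr x), smul_eq_mul, mul_comm]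

theorem measurable_gammaPDF (a r : ℝ) : Measurable (gammaPDF a r) :=
  (measurable_gammaPDFReal a r).ennreal_ofReal

theorem integrable_pow_gammaMeasure {a r : ℝ} (ha : 0 < a) (hr : 0 < r) (k : ℕ) :
    Integrable (fun x => x ^ k) (gammaMeasure a r) := by
  rw [gammaMeasure, integrable_withDensity_iff_integrable_smul' (measurable_gammaPDF a r)
    (ae_of_all _ fun _ => ENNReal.ofReal_lt_top), integrable_congr (pow_mul_gammaPDFReal_ae ha hr k)]
  exact (integrable_gammaPDFReal (by positivity) hr).const_mul _

theorem integral_pow_gammaMeasure {a r : ℝ} (ha : 0 < a) (hr : 0 < r) (k : ℕ) :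
    ∫ x, x ^ k ∂(gammaMeasure a r) = Real.Gamma (a + k) / (Real.Gamma a * r ^ k) := by
  rw [gammaMeasure, integral_withDensity_eq_integral_toReal_smul (measurable_gammaPDF a r)
    (ae_of_all _ fun _ => ENNReal.ofReal_lt_top), integral_congr_ae (pow_mul_gammaPDFReal_ae ha hr k),
    integral_const_mul, integral_gammaPDFReal (by positivity) hr, mul_one]

theorem integral_pow_chiSquared {d : ℕ} (hd : 0 < d) (k : ℕ) :
    ∫ x, x ^ k ∂(chiSquared d) = chiMoment d k := by
  have hd' : (0 : ℝ) < d := by exact_mod_cast hd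
  have hG := two_pow_mul_Gamma_add hd' k
  have h1 := (Real.Gamma_pos_of_pos (by positivity : 0 < (d : ℝ) / 2)).ne'
  rw [chiSquared, integral_pow_gammaMeasure (by positivity) (by norm_num), div_eq_iff (by positivity),
    one_div, inv_pow]
  generalize Real.Gamma ((d : ℝ) / 2 + k) = G at *
  field_simp
  linear_combination hG

/-! ### The algebra of random variables with all moments -/

/-- A random variable all of whose moments are finite. -/
def HasAllMoments {Ω : Type*} [MeasurableSpace Ω] (f : Ω → ℝ) (μ : Measure Ω) : Prop :=
  ∀ p : ENNReal, p ≠ ⊤ → MemLp f p μ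

namespace HasAllMoments

variable {Ω : Type*} [MeasurableSpace Ω] {μ : Measure Ω} {f g : Ω → ℝ}

theorem integrable (hf : HasAllMoments f μ) : Integrable f μ :=
  memLp_one_iff_integrable.1 (hf 1 ENNReal.one_ne_top)

theorem congr (hf : HasAllMoments f μ) (h : f =ᵐ[μ] g) : HasAllMoments g μ :=
  fun p hp => (memLp_congr_ae h).1 (hf p hp)

theorem const [IsFiniteMeasure μ] (c : ℝ) : HasAllMoments (fun _ : Ω => c) μ :=
  fun _ _ => memLp_const c

theorem add (hf : HasAllMoments f μ) (hg : HasAllMoments g μ) :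
    HasAllMoments (fun x => f x + g x) μ :=
  fun p hp => (hf p hp).add (hg p hp)

/-- Hölder's inequality with exponents `2 p`, `2 p` and `p`. -/
theorem mul (hf : HasAllMoments f μ) (hg : HasAllMoments g μ) :
    HasAllMoments (fun x => f x * g x) μ := by
  intro p hp
  have h2 : 2 * p ≠ ⊤ := ENNReal.mul_ne_top (by norm_num) hp
  have : ENNReal.HolderTriple (2 * p) (2 * p) p := ⟨by
    rw [ENNReal.mul_inv (by simp) (by simp), ← add_mul, ENNReal.inv_two_add_inv_two, one_mul]⟩
  exact (hg (2 * p) h2).mul' (hf (2 * p) h2)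

theorem pow [IsFiniteMeasure μ] (hf : HasAllMoments f μ) (k : ℕ) :
    HasAllMoments (fun x => f x ^ k) μ := by
  induction k with
  | zero => simpa using const 1
  | succ k ih => simpa only [pow_succ] using ih.mul hf

theorem sum [IsFiniteMeasure μ] {ι : Type*} (s : Finset ι) {F : ι → Ω → ℝ}
    (h : ∀ i ∈ s, HasAllMoments (F i) μ) : HasAllMoments (fun x => ∑ i ∈ s, F i x) μ := by
  classical
  induction s using Finset.induction_on with
  | empty => simpa using const 0
  | insert a s ha ih =>
    simp only [Finset.sum_insert ha]
    exact (h a (Finset.mem_insert_self a s)).add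
      (ih fun i hi => h i (Finset.mem_insert_of_mem hi))

theorem prod [IsFiniteMeasure μ] {ι : Type*} (s : Finset ι) {F : ι → Ω → ℝ}
    (h : ∀ i ∈ s, HasAllMoments (F i) μ) : HasAllMoments (fun x => ∏ i ∈ s, F i x) μ := by
  classical
  induction s using Finset.induction_on with
  | empty => simpa using const 1
  | insert a s ha ih =>
    simp only [Finset.prod_insert ha]
    exact (h a (Finset.mem_insert_self a s)).mul
      (ih fun i hi => h i (Finset.mem_insert_of_mem hi))

theorem det [IsFiniteMeasure μ] {N : ℕ} {F : Ω → Matrix (Fin N) (Fin N) ℝ}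
    (h : ∀ i j, HasAllMoments (fun x => F x i j) μ) : HasAllMoments (fun x => (F x).det) μ := by
  simp only [Matrix.det_apply']
  exact sum _ fun σ _ => (const _).mul (prod _ fun i _ => h _ _)

theorem comp_hasLaw {Ω' : Type*} [MeasurableSpace Ω'] {P : Measure Ω'} {X : Ω' → Ω}
    (hf : HasAllMoments f μ) (hX : HasLaw X μ P) : HasAllMoments (fun ω => f (X ω)) P := by
  intro p hp
  have h := hf p hp
  rw [← hX.map_eq] at h
  exact (memLp_map_measure_iff h.1 hX.aemeasurable).1 h

theorem comp_fst {Ω' : Type*} [MeasurableSpace Ω'] {ν : Measure Ω'} [IsProbabilityMeasure ν]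
    [SFinite μ] (hf : HasAllMoments f μ) :
    HasAllMoments (fun x : Ω × Ω' => f x.1) (μ.prod ν) :=
  fun p hp => (hf p hp).comp_fst ν

theorem comp_snd {Ω' : Type*} [MeasurableSpace Ω'] {ν : Measure Ω'} [IsProbabilityMeasure ν]
    [SFinite μ] (hf : HasAllMoments f μ) :
    HasAllMoments (fun x : Ω' × Ω => f x.2) (ν.prod μ) :=
  fun p hp => (hf p hp).comp_snd ν

end HasAllMoments

theorem hasAllMoments_gaussianReal (m : ℝ) (v : NNReal) :
    HasAllMoments (fun x => x) (gaussianReal m v) :=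
  fun p hp => memLp_id_gaussianReal' p hp

theorem hasAllMoments_gammaMeasure {a r : ℝ} (ha : 0 < a) (hr : 0 < r) :
    HasAllMoments (fun x => x) (gammaMeasure a r) := by
  have := isProbabilityMeasure_gammaMeasure ha hr
  intro p hp
  obtain ⟨k, hk⟩ := ENNReal.exists_nat_gt hp
  have hk0 : k ≠ 0 := by rintro rfl; simp at hk
  refine MemLp.mono_exponent (q := k) ?_ hk.le
  rw [← integrable_norm_rpow_iff (by fun_prop) (by simpa using hk0) (by simp)]
  simpa using (integrable_pow_gammaMeasure ha hr k).norm

/-! ### Bordered matrices and Householder reflections -/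

/-- The symmetric bordering of a square matrix by a vector and a corner entry. -/
def border {N : ℕ} (x : Fin N → Fin N → ℝ) (v : Fin N → ℝ) (a : ℝ) :
    Fin (N + 1) → Fin (N + 1) → ℝ :=
  Fin.snoc (α := fun _ => Fin (N + 1) → ℝ)
    (fun i => Fin.snoc (α := fun _ => ℝ) (x i) (v i)) (Fin.snoc (α := fun _ => ℝ) v a)

section border

variable {N : ℕ} (x : Fin N → Fin N → ℝ) (v : Fin N → ℝ) (a : ℝ)

@[simp] theorem border_castSucc_castSucc (i j : Fin N) :
    border x v a i.castSucc j.castSucc = x i j := by simp [border]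

@[simp] theorem border_castSucc_last (i : Fin N) :
    border x v a i.castSucc (Fin.last N) = v i := by simp [border]

@[simp] theorem border_last_castSucc (j : Fin N) :
    border x v a (Fin.last N) j.castSucc = v j := by simp [border]

@[simp] theorem border_last_last : border x v a (Fin.last N) (Fin.last N) = a := by simp [border]

theorem submatrix_border :
    (Matrix.of (border x v a)).submatrix Fin.castSucc Fin.castSucc = Matrix.of x := by
  ext i j
  simp

/-- Expand along the last row and then the last column: only the corner and the two symmetric
entries `c` survive. -/
theorem det_border_single (x : Fin (N + 1) → Fin (N + 1) → ℝ) (c a : ℝ) :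
    (Matrix.of (border x (Pi.single (Fin.last N) c) a)).det
      = a * (Matrix.of x).det
        - c ^ 2 * ((Matrix.of x).submatrix Fin.castSucc Fin.castSucc).det := by
  set v : Fin (N + 1) → ℝ := Pi.single (Fin.last N) c with hv
  have hv0 (i : Fin N) : v i.castSucc = 0 := by
    simp [hv, (Fin.castSucc_lt_last i).ne]
  have hv1 : v (Fin.last N) = c := by simp [hv]
  rw [Matrix.det_succ_row _ (Fin.last (N + 1)), Fin.sum_univ_castSucc, Fin.sum_univ_castSucc]
  simp only [Matrix.of_apply, border_last_castSucc, border_last_last, hv0, hv1, mul_zero, zero_mul,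
    Finset.sum_const_zero, zero_add, Fin.succAbove_last, submatrix_border]
  rw [Matrix.det_succ_column _ (Fin.last N), Fin.sum_univ_castSucc]
  have hlast : (Fin.last N).castSucc.succAbove (Fin.last N) = Fin.last (N + 1) := by
    rw [Fin.succAbove_of_le_castSucc _ _ le_rfl, Fin.succ_last]
  have hcast (i : Fin N) : (Fin.last N).castSucc.succAbove i.castSucc = i.castSucc.castSucc := by
    rw [Fin.succAbove_of_castSucc_lt]
    simp
  simp only [Matrix.submatrix_apply, hlast, Matrix.of_apply, border_castSucc_last, hv0, hv1,
    mul_zero, zero_mul, Finset.sum_const_zero, zero_add, Matrix.submatrix_submatrix,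
    Fin.succAbove_last]
  have hsub : (Matrix.of (border x v a)).submatrix (Fin.castSucc ∘ Fin.castSucc)
      ((Fin.last N).castSucc.succAbove ∘ Fin.castSucc)
      = (Matrix.of x).submatrix Fin.castSucc Fin.castSucc := by
    ext i j
    simp [hcast]
  rw [hsub]
  simp only [Fin.val_last, Fin.val_castSucc]
  have e1 : (-1 : ℝ) ^ (N + 1 + N) = -1 := Odd.neg_one_pow ⟨N, by ring⟩
  have e2 : (-1 : ℝ) ^ (N + N) = 1 := Even.neg_one_pow ⟨N, rfl⟩
  have e3 : (-1 : ℝ) ^ (N + 1 + (N + 1)) = 1 := Even.neg_one_pow ⟨N + 1, rfl⟩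
  rw [e1, e2, e3]
  ring

/-- The two bordered matrices are conjugate under the block matrix `diag(H, 1)`, whose determinant
squares to one. -/
theorem det_border_conj (H : Matrix (Fin N) (Fin N) ℝ) (hs : H.transpose = H) (hH : H * H = 1) :
    (Matrix.of (border (fun i j => (H * Matrix.of x * H) i j) v a)).det
      = (Matrix.of (border x (H.mulVec v) a)).det := by
  set K : Matrix (Fin (N + 1)) (Fin (N + 1)) ℝ := Matrix.of (border (fun i j => H i j) 0 1) with hK
  have hHs (i j : Fin N) : H i j = H j i := by
    conv_lhs => rw [← hs]
    rfl
  have hvv : H.mulVec (H.mulVec v) = v := by rw [Matrix.mulVec_mulVec, hH, Matrix.one_mulVec]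
  have h1 : Matrix.of (border (fun i j => (H * Matrix.of x * H) i j) v a)
      = K * Matrix.of (border x (H.mulVec v) a) * K := by
    ext i j
    refine Fin.lastCases ?_ (fun i => ?_) i <;> refine Fin.lastCases ?_ (fun j => ?_) j
    · simp [Matrix.mul_apply, Fin.sum_univ_castSucc, hK]
    · have := congrFun hvv j
      simp only [Matrix.mulVec, dotProduct] at this
      simp [Matrix.mul_apply, Fin.sum_univ_castSucc, hK, Matrix.mulVec, dotProduct]
      rw [← this]
      refine Finset.sum_congr rfl fun k _ => ?_
      rw [hHs j k, mul_comm]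
    · have := congrFun hvv i
      simp only [Matrix.mulVec, dotProduct] at this
      simp [Matrix.mul_apply, Fin.sum_univ_castSucc, hK, Matrix.mulVec, dotProduct]
      rw [← this]
    · simp [Matrix.mul_apply, Fin.sum_univ_castSucc, hK]
  have h2 : K * K = 1 := by
    ext i j
    refine Fin.lastCases ?_ (fun i => ?_) i <;> refine Fin.lastCases ?_ (fun j => ?_) j
    · simp [Matrix.mul_apply, Fin.sum_univ_castSucc, hK]
    · simp [Matrix.mul_apply, Fin.sum_univ_castSucc, hK,
        (Fin.castSucc_lt_last j).ne']
    · simp [Matrix.mul_apply, Fin.sum_univ_castSucc, hK,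
        (Fin.castSucc_lt_last i).ne]
    · have := congrFun (congrFun hH i) j
      simpa [Matrix.mul_apply, Fin.sum_univ_castSucc, hK, Matrix.one_apply] using this
  have h3 : K.det * K.det = 1 := by rw [← Matrix.det_mul, h2, Matrix.det_one]
  rw [h1, Matrix.det_mul, Matrix.det_mul]
  linear_combination (Matrix.of (border x (H.mulVec v) a)).det * h3

end border

/-- A Householder reflection that sends a given vector to a multiple of the last basis vector. -/
theorem exists_householder {N : ℕ} (v : Fin (N + 1) → ℝ) :
    ∃ (H : Matrix (Fin (N + 1)) (Fin (N + 1)) ℝ) (c : ℝ), H.transpose = H ∧ H * H = 1 ∧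
      H.mulVec v = Pi.single (Fin.last N) c ∧ c ^ 2 = ∑ i, v i ^ 2 := by
  set c := √(∑ i, v i ^ 2) with hc
  have hc2 : c ^ 2 = ∑ i, v i ^ 2 := Real.sq_sqrt (Finset.sum_nonneg fun i _ => sq_nonneg _)
  set e : Fin (N + 1) → ℝ := Pi.single (Fin.last N) c with he
  set w := v - e with hw
  have hvv : v ⬝ᵥ v = c ^ 2 := by rw [hc2]; simp [dotProduct, sq]
  have hee : e ⬝ᵥ e = c ^ 2 := by simp [he, sq]
  have hww : w ⬝ᵥ w = 2 * (w ⬝ᵥ v) := by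
    have h1 : e ⬝ᵥ v = v ⬝ᵥ e := dotProduct_comm _ _
    simp only [hw, sub_dotProduct, dotProduct_sub, hvv, hee, h1]
    ring
  -- If `w = 0` the identity serves; otherwise the reflection in the hyperplane orthogonal to `w`
  -- exchanges `v` and `e`, which have equal length.
  by_cases h0 : w ⬝ᵥ w = 0
  · have hw0 : w = 0 := dotProduct_self_eq_zero.1 h0
    exact ⟨1, c, Matrix.transpose_one, mul_one _, by
      rw [Matrix.one_mulVec]; exact sub_eq_zero.1 hw0, hc2⟩
  · refine ⟨1 - (2 / (w ⬝ᵥ w)) • Matrix.vecMulVec w w, c, ?_, ?_, ?_, hc2⟩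
    · rw [Matrix.transpose_sub, Matrix.transpose_one, Matrix.transpose_smul,
        Matrix.transpose_vecMulVec]
    · have hsq : Matrix.vecMulVec w w * Matrix.vecMulVec w w = (w ⬝ᵥ w) • Matrix.vecMulVec w w := by
        ext i j
        simp only [Matrix.mul_apply, Matrix.vecMulVec_apply, Matrix.smul_apply, smul_eq_mul,
          dotProduct, Finset.sum_mul]
        exact Finset.sum_congr rfl fun k _ => by ring
      rw [sub_mul, mul_sub, mul_sub, one_mul, mul_one, one_mul, Matrix.smul_mul, Matrix.mul_smul,
        hsq, smul_smul, smul_smul, show 2 / (w ⬝ᵥ w) * (2 / (w ⬝ᵥ w)) * (w ⬝ᵥ w)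
          = 2 / (w ⬝ᵥ w) + 2 / (w ⬝ᵥ w) by field_simp; norm_num, add_smul]
      abel
    · ext i
      have hv' : w ⬝ᵥ v = (w ⬝ᵥ w) / 2 := by linarith
      have hi : ((2 / (w ⬝ᵥ w)) • Matrix.vecMulVec w w).mulVec v i
          = 2 / (w ⬝ᵥ w) * (w i * (w ⬝ᵥ v)) := by
        simp only [Matrix.mulVec, dotProduct, Matrix.smul_apply, Matrix.vecMulVec_apply,
          smul_eq_mul, Finset.mul_sum]
        exact Finset.sum_congr rfl fun k _ => by ring
      rw [Matrix.sub_mulVec, Matrix.one_mulVec, Pi.sub_apply, hi, hv']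
      have : w i = v i - e i := rfl
      field_simp
      rw [this]
      ring

theorem measurable_border {N : ℕ} : Measurable
    (fun p : (Fin N → Fin N → ℝ) × (Fin N → ℝ) × ℝ => border p.1 p.2.1 p.2.2) := by
  refine measurable_pi_lambda _ fun i => measurable_pi_lambda _ fun j => ?_
  refine Fin.lastCases ?_ (fun i => ?_) i <;> refine Fin.lastCases ?_ (fun j => ?_) j <;>
    simp only [border_castSucc_castSucc, border_castSucc_last, border_last_castSucc,
      border_last_last] <;> fun_prop

/-! ### The GOE by bordering and its characteristic function -/

/-- The law of the last column of a GOE matrix: its off-diagonal part and its corner entry. -/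
noncomputable def goeColumn (N : ℕ) : Measure ((Fin N → ℝ) × ℝ) :=
  (Measure.pi fun _ => gaussianReal 0 1).prod (gaussianReal 0 2)

instance (N : ℕ) : IsProbabilityMeasure (goeColumn N) := by
  unfold goeColumn; infer_instance

/-- The Gaussian Orthogonal Ensemble, built by successive borderings. -/
noncomputable def goe : (N : ℕ) → Measure (Fin N → Fin N → ℝ)
  | 0 => Measure.dirac 0
  | N + 1 => ((goe N).prod (goeColumn N)).map fun p => border p.1 p.2.1 p.2.2

instance goe.isProbabilityMeasure : (N : ℕ) → IsProbabilityMeasure (goe N)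
  | 0 => by unfold goe; infer_instance
  | N + 1 => by
    have := goe.isProbabilityMeasure N
    unfold goe
    exact Measure.isProbabilityMeasure_map measurable_border.aemeasurable

/-- The pairing `tr (Bᵀ x)`. -/
def matrixPairing {N : ℕ} (B x : Fin N → Fin N → ℝ) : ℝ := ∑ i, ∑ j, B i j * x i j

/-- The variance of `matrixPairing B M` for a GOE matrix `M`. -/
def goeVariance {N : ℕ} (B : Fin N → Fin N → ℝ) : ℝ := ∑ i, ∑ j, (B i j ^ 2 + B i j * B j i)

/-- The measure `μ` has the characteristic function of the Gaussian Orthogonal Ensemble. -/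
def HasGOECharFun {N : ℕ} (μ : Measure (Fin N → Fin N → ℝ)) : Prop :=
  ∀ B : Fin N → Fin N → ℝ,
    ∫ x, Complex.exp ((matrixPairing B x : ℝ) * Complex.I) ∂μ
      = Complex.exp ((-(goeVariance B) / 2 : ℝ) : ℂ)

theorem measurable_matrixPairing {N : ℕ} (B : Fin N → Fin N → ℝ) :
    Measurable (matrixPairing B) := by
  unfold matrixPairing
  fun_prop

/-- Every continuous linear functional on this finite-dimensional space is a `matrixPairing`. -/
theorem HasGOECharFun.ext {N : ℕ} {μ ν : Measure (Fin N → Fin N → ℝ)} [IsFiniteMeasure μ]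
    [IsFiniteMeasure ν] (hμ : HasGOECharFun μ) (hν : HasGOECharFun ν) : μ = ν := by
  apply Measure.ext_of_charFunDual
  ext L
  set B : Fin N → Fin N → ℝ := fun i j => L (Pi.single i (Pi.single j 1)) with hB
  have hL (x : Fin N → Fin N → ℝ) : L x = matrixPairing B x := by
    have hx : x = ∑ i, ∑ j, x i j • (Pi.single i (Pi.single j 1) : Fin N → Fin N → ℝ) := by
      ext a b
      rw [Finset.sum_apply, Finset.sum_apply, Finset.sum_eq_single a]
      · rw [Finset.sum_apply, Finset.sum_apply, Finset.sum_eq_single b]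
        · simp
        · intro j _ hj
          simp [Pi.single_eq_of_ne hj.symm]
        · simp
      · intro i _ hi
        rw [Finset.sum_apply, Finset.sum_apply]
        exact Finset.sum_eq_zero fun j _ => by simp [Pi.single_eq_of_ne hi.symm]
      · simp
    conv_lhs => rw [hx]
    simp only [map_sum, map_smul, smul_eq_mul, matrixPairing, hB]
    exact Finset.sum_congr rfl fun i _ => Finset.sum_congr rfl fun j _ => mul_comm _ _
  rw [charFunDual_apply, charFunDual_apply]
  simp_rw [hL]
  rw [hμ B, hν B]

theorem integral_cexp_gaussianReal (v : NNReal) (t : ℝ) :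
    ∫ x : ℝ, Complex.exp ((t * x : ℝ) * Complex.I) ∂(gaussianReal 0 v)
      = Complex.exp ((-(v * t ^ 2) / 2 : ℝ) : ℂ) := by
  have h := charFun_gaussianReal (μ := 0) (v := v) t
  rw [charFun_apply_real] at h
  convert h using 2
  · ext x
    push_cast
    ring_nf
  · push_cast
    ring_nf

theorem integral_cexp_pi_gaussianReal {N : ℕ} (b : Fin N → ℝ) :
    ∫ v : Fin N → ℝ, Complex.exp ((∑ i, b i * v i : ℝ) * Complex.I)
        ∂(Measure.pi fun _ => gaussianReal 0 1)
      = Complex.exp ((-(∑ i, b i ^ 2) / 2 : ℝ) : ℂ) := by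
  have h (v : Fin N → ℝ) : Complex.exp ((∑ i, b i * v i : ℝ) * Complex.I)
      = ∏ i, (fun i (x : ℝ) => Complex.exp ((b i * x : ℝ) * Complex.I)) i (v i) := by
    rw [← Complex.exp_sum, Complex.ofReal_sum, Finset.sum_mul]
  simp_rw [h]
  rw [integral_fintype_prod_eq_prod
    (f := fun i (x : ℝ) => Complex.exp ((b i * x : ℝ) * Complex.I))]
  simp_rw [integral_cexp_gaussianReal]
  rw [← Complex.exp_sum, ← Complex.ofReal_sum]
  congr 2
  rw [← Finset.sum_div, ← Finset.sum_neg_distrib]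
  simp

theorem matrixPairing_border {N : ℕ} (B : Fin (N + 1) → Fin (N + 1) → ℝ)
    (x : Fin N → Fin N → ℝ) (v : Fin N → ℝ) (a : ℝ) :
    matrixPairing B (border x v a)
      = matrixPairing (fun i j => B i.castSucc j.castSucc) x
        + (∑ i, (B i.castSucc (Fin.last N) + B (Fin.last N) i.castSucc) * v i
          + B (Fin.last N) (Fin.last N) * a) := by
  simp only [matrixPairing, Fin.sum_univ_castSucc, border_castSucc_castSucc, border_castSucc_last,
    border_last_castSucc, border_last_last, Finset.sum_add_distrib, add_mul]
  ring

theorem goeVariance_succ {N : ℕ} (B : Fin (N + 1) → Fin (N + 1) → ℝ) :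
    goeVariance B = goeVariance (fun i j : Fin N => B i.castSucc j.castSucc)
      + (∑ i : Fin N, (B i.castSucc (Fin.last N) + B (Fin.last N) i.castSucc) ^ 2
        + 2 * B (Fin.last N) (Fin.last N) ^ 2) := by
  simp only [goeVariance, Fin.sum_univ_castSucc, Finset.sum_add_distrib, add_sq, mul_assoc,
    ← Finset.mul_sum]
  have : ∑ i : Fin N, B (Fin.last N) i.castSucc * B i.castSucc (Fin.last N)
      = ∑ i : Fin N, B i.castSucc (Fin.last N) * B (Fin.last N) i.castSucc :=
    Finset.sum_congr rfl fun i _ => mul_comm _ _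
  rw [this]
  ring

theorem hasGOECharFun_goe (N : ℕ) : HasGOECharFun (goe N) := by
  induction N with
  | zero =>
    intro B
    simp [goe, matrixPairing, goeVariance]
  | succ N ih =>
    intro B
    have hm := measurable_matrixPairing B
    rw [goe, integral_map measurable_border.aemeasurable (by fun_prop)]
    have h1 (p : (Fin N → Fin N → ℝ) × (Fin N → ℝ) × ℝ) :
        Complex.exp ((matrixPairing B (border p.1 p.2.1 p.2.2) : ℝ) * Complex.I)
          = Complex.exp ((matrixPairing (fun i j : Fin N => B i.castSucc j.castSucc) p.1 : ℝ)
            * Complex.I)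
          * (Complex.exp ((∑ i : Fin N, (B i.castSucc (Fin.last N)
            + B (Fin.last N) i.castSucc) * p.2.1 i : ℝ) * Complex.I)
          * Complex.exp ((B (Fin.last N) (Fin.last N) * p.2.2 : ℝ) * Complex.I)) := by
      rw [matrixPairing_border, Complex.ofReal_add, Complex.ofReal_add, add_mul, add_mul,
        Complex.exp_add, Complex.exp_add]
    simp_rw [h1]
    rw [integral_prod_mul (fun x => Complex.exp
        ((matrixPairing (fun i j : Fin N => B i.castSucc j.castSucc) x : ℝ) * Complex.I))
        (fun q : (Fin N → ℝ) × ℝ => Complex.exp ((∑ i : Fin N, (B i.castSucc (Fin.last N)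
            + B (Fin.last N) i.castSucc) * q.1 i : ℝ) * Complex.I)
          * Complex.exp ((B (Fin.last N) (Fin.last N) * q.2 : ℝ) * Complex.I)), ih, goeColumn,
      integral_prod_mul (fun v : Fin N → ℝ => Complex.exp ((∑ i, (B i.castSucc (Fin.last N)
        + B (Fin.last N) i.castSucc) * v i : ℝ) * Complex.I))
      (fun a : ℝ => Complex.exp ((B (Fin.last N) (Fin.last N) * a : ℝ) * Complex.I)),
      integral_cexp_pi_gaussianReal, integral_cexp_gaussianReal, ← Complex.exp_add,
      ← Complex.exp_add, goeVariance_succ]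
    congr 1
    push_cast
    ring

/-! ### Invariance under reflections and negation -/

/-- Conjugation of a matrix, given as a function of its indices, by a symmetric matrix. -/
noncomputable def conjFun {N : ℕ} (H : Matrix (Fin N) (Fin N) ℝ) (x : Fin N → Fin N → ℝ) :
    Fin N → Fin N → ℝ := fun i j => (H * Matrix.of x * H) i j

theorem measurable_conjFun {N : ℕ} (H : Matrix (Fin N) (Fin N) ℝ) : Measurable (conjFun H) := by
  refine measurable_pi_lambda _ fun i => measurable_pi_lambda _ fun j => ?_
  simp only [conjFun, Matrix.mul_apply, Matrix.of_apply]
  fun_prop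

theorem matrixPairing_eq_trace {N : ℕ} (B x : Fin N → Fin N → ℝ) :
    matrixPairing B x = ((Matrix.of B).transpose * Matrix.of x).trace := by
  simp only [matrixPairing, Matrix.trace, Matrix.diag, Matrix.mul_apply, Matrix.transpose_apply,
    Matrix.of_apply]
  exact Finset.sum_comm

theorem goeVariance_eq_trace {N : ℕ} (B : Fin N → Fin N → ℝ) :
    goeVariance B = ((Matrix.of B).transpose * Matrix.of B).trace
      + (Matrix.of B * Matrix.of B).trace := by
  rw [← matrixPairing_eq_trace]
  simp only [goeVariance, matrixPairing, Finset.sum_add_distrib, Matrix.trace, Matrix.diag,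
    Matrix.mul_apply, Matrix.of_apply, sq]

/-- The trace pairing moves the conjugation onto `B`, and the trace form of the variance is
unchanged by it. -/
theorem goe_map_conjFun {N : ℕ} {H : Matrix (Fin N) (Fin N) ℝ} (hs : H.transpose = H)
    (hH : H * H = 1) : (goe N).map (conjFun H) = goe N := by
  have := Measure.isProbabilityMeasure_map (μ := goe N) (measurable_conjFun H).aemeasurable
  refine HasGOECharFun.ext (fun B => ?_) (hasGOECharFun_goe N)
  have hm := measurable_matrixPairing B
  rw [integral_map (measurable_conjFun H).aemeasurable (by fun_prop)]
  have hof (C : Fin N → Fin N → ℝ) : Matrix.of (conjFun H C) = H * Matrix.of C * H := rfl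
  have h1 (x : Fin N → Fin N → ℝ) :
      matrixPairing B (conjFun H x) = matrixPairing (conjFun H B) x := by
    rw [matrixPairing_eq_trace, matrixPairing_eq_trace, hof, hof, Matrix.transpose_mul,
      Matrix.transpose_mul, hs, ← mul_assoc, Matrix.trace_mul_comm]
    simp only [mul_assoc]
  have h2 : goeVariance (conjFun H B) = goeVariance B := by
    have e1 (C D : Matrix (Fin N) (Fin N) ℝ) : (H * (C * (H * (H * (D * H))))).trace
        = (C * D).trace := by
      rw [show H * (C * (H * (H * (D * H)))) = H * (C * (H * H) * D * H) by simp only [mul_assoc],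
        hH, Matrix.trace_mul_comm, mul_one, mul_assoc, mul_assoc, hH, mul_one]
    rw [goeVariance_eq_trace, goeVariance_eq_trace, hof, Matrix.transpose_mul,
      Matrix.transpose_mul, hs]
    simp only [mul_assoc]
    rw [e1, e1]
  simp_rw [h1]
  rw [hasGOECharFun_goe, h2]

theorem goe_map_neg (N : ℕ) : (goe N).map (fun x => -x) = goe N := by
  have := Measure.isProbabilityMeasure_map (μ := goe N) (f := fun x => -x) (by fun_prop)
  refine HasGOECharFun.ext (fun B => ?_) (hasGOECharFun_goe N)
  have hm := measurable_matrixPairing B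
  rw [integral_map (by fun_prop) (by fun_prop)]
  have h1 (x : Fin N → Fin N → ℝ) : matrixPairing B (-x) = matrixPairing (-B) x := by
    simp [matrixPairing]
  simp_rw [h1]
  rw [hasGOECharFun_goe]
  simp [goeVariance]

/-! ### Moments of the entries and of the bordering vector -/

theorem hasAllMoments_pi_gaussianReal {N : ℕ} (i : Fin N) :
    HasAllMoments (fun v : Fin N → ℝ => v i) (Measure.pi fun _ => gaussianReal 0 1) :=
  (hasAllMoments_gaussianReal 0 1).comp_hasLaw
    (measurePreserving_eval (fun _ : Fin N => gaussianReal 0 1) i).hasLaw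

theorem hasAllMoments_goe (N : ℕ) (i j : Fin N) : HasAllMoments (fun x => x i j) (goe N) := by
  induction N with
  | zero => exact i.elim0
  | succ N ih =>
    intro p hp
    have hm : Measurable fun x : Fin (N + 1) → Fin (N + 1) → ℝ => x i j :=
      (measurable_pi_apply j).comp (measurable_pi_apply i)
    rw [goe, memLp_map_measure_iff hm.aestronglyMeasurable measurable_border.aemeasurable]
    clear hm
    revert i j
    refine fun i => Fin.lastCases (fun j => ?_) (fun i j => ?_) i <;>
      refine Fin.lastCases ?_ (fun j => ?_) j <;>
      simp only [Function.comp_def, border_castSucc_castSucc, border_castSucc_last,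
        border_last_castSucc, border_last_last]
    · exact (hasAllMoments_gaussianReal 0 2).comp_snd.comp_snd p hp
    · exact (hasAllMoments_pi_gaussianReal j).comp_fst.comp_snd p hp
    · exact (hasAllMoments_pi_gaussianReal i).comp_fst.comp_snd p hp
    · exact (ih i j).comp_fst p hp

/-- One coordinate is added at a time; the binomial expansion becomes the Vandermonde identity, so
the law of the squared norm is not needed. -/
theorem integral_sum_sq_pow_pi_gaussianReal (N q : ℕ) :
    ∫ v : Fin N → ℝ, (∑ i, v i ^ 2) ^ q ∂(Measure.pi fun _ => gaussianReal 0 1)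
      = chiMoment N q := by
  induction N generalizing q with
  | zero =>
    rcases q with _ | q
    · simp
    · simp [chiMoment, Finset.prod_range_succ']
  | succ N ih =>
    have hmp := (measurePreserving_piFinSuccAbove (fun _ : Fin (N + 1) => gaussianReal 0 1) 0).symm
    rw [← hmp.integral_comp']
    have h1 (p : ℝ × (Fin N → ℝ)) :
        (∑ i, (MeasurableEquiv.piFinSuccAbove (fun _ : Fin (N + 1) => ℝ) 0).symm p i ^ 2) ^ q
          = ∑ ij ∈ Finset.HasAntidiagonal.antidiagonal q,
            (q.choose ij.2 : ℝ) * (p.1 ^ (2 * ij.1) * (∑ i, p.2 i ^ 2) ^ ij.2) := by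
      simp only [MeasurableEquiv.piFinSuccAbove_symm_apply, Fin.insertNthEquiv,
        Fin.sum_univ_succ, Fin.insertNth_zero, Equiv.coe_fn_mk, Fin.cons_succ,
        Fin.zero_succAbove, cast_eq, Fin.cons_zero]
      rw [Commute.add_pow' (Commute.all _ _)]
      refine Finset.sum_congr rfl fun ij hij => ?_
      have h : ij.1 + ij.2 = q := Finset.HasAntidiagonal.mem_antidiagonal.1 hij
      rw [nsmul_eq_mul, ← pow_mul, ← h, Nat.choose_symm_add]
    simp_rw [h1]
    rw [integral_finsetSum]
    · rw [Nat.cast_succ, add_comm, chiMoment_vandermonde]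
      refine Finset.sum_congr rfl fun ij hij => ?_
      have h : ij.1 + ij.2 = q := Finset.HasAntidiagonal.mem_antidiagonal.1 hij
      rw [integral_const_mul, integral_prod_mul (fun x : ℝ => x ^ (2 * ij.1))
        (fun v : Fin N → ℝ => (∑ i, v i ^ 2) ^ ij.2), integral_even_pow_gaussianReal, ih, ← h,
        Nat.choose_symm_add]
    · intro ij _
      have h2 : HasAllMoments (fun v : Fin N → ℝ => ∑ i, v i ^ 2)
          (Measure.pi fun _ => gaussianReal 0 1) :=
        HasAllMoments.sum _ fun i _ => (hasAllMoments_pi_gaussianReal i).pow 2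
      exact ((HasAllMoments.const _).mul
        ((((hasAllMoments_gaussianReal 0 1).pow (2 * ij.1)).comp_fst).mul
          ((h2.pow ij.2).comp_snd))).integrable

/-! ### The recursion for joint determinant moments -/

/-- The determinant of the leading minor of size one less. -/
noncomputable def leadingMinor {N : ℕ} (x : Fin (N + 1) → Fin (N + 1) → ℝ) : ℝ :=
  ((Matrix.of x).submatrix Fin.castSucc Fin.castSucc).det

theorem hasAllMoments_det_goe (N : ℕ) : HasAllMoments (fun x => (Matrix.of x).det) (goe N) :=
  HasAllMoments.det fun i j => hasAllMoments_goe N i j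

theorem hasAllMoments_leadingMinor_goe (N : ℕ) : HasAllMoments leadingMinor (goe (N + 1)) :=
  HasAllMoments.det fun i j => hasAllMoments_goe (N + 1) i.castSucc j.castSucc

theorem measurable_det_of {N : ℕ} :
    Measurable fun x : Fin N → Fin N → ℝ => (Matrix.of x).det := by
  simp only [Matrix.det_apply', Matrix.of_apply]
  fun_prop

theorem measurable_leadingMinor {N : ℕ} :
    Measurable fun x : Fin (N + 1) → Fin (N + 1) → ℝ => leadingMinor x := by
  simp only [leadingMinor, Matrix.det_apply', Matrix.submatrix_apply, Matrix.of_apply]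
  fun_prop

/-- Averaging over a GOE matrix, the bordering vector may be rotated to the last basis vector. -/
theorem integral_det_border {N : ℕ} (v : Fin (N + 1) → ℝ) (a : ℝ) (α β : ℕ) :
    ∫ x, (Matrix.of (border x v a)).det ^ α * (Matrix.of x).det ^ β ∂(goe (N + 1))
      = ∫ x, (a * (Matrix.of x).det - (∑ i, v i ^ 2) * leadingMinor x) ^ α
        * (Matrix.of x).det ^ β ∂(goe (N + 1)) := by
  obtain ⟨H, c, hs, hH, hv, hc⟩ := exists_householder v
  have hb : Measurable fun x : Fin (N + 1) → Fin (N + 1) → ℝ => border x v a :=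
    measurable_border.comp (by fun_prop : Measurable fun x => (x, v, a))
  have hm : Measurable fun x : Fin (N + 1) → Fin (N + 1) → ℝ =>
      (Matrix.of (border x v a)).det ^ α * (Matrix.of x).det ^ β :=
    ((measurable_det_of.comp hb).pow_const α).mul (measurable_det_of.pow_const β)
  conv_lhs => rw [← goe_map_conjFun hs hH]
  rw [integral_map (measurable_conjFun H).aemeasurable hm.aestronglyMeasurable]
  congr 1
  ext x
  have h1 : (Matrix.of (conjFun H x)).det = (Matrix.of x).det := by
    have h2 : H.det * H.det = 1 := by rw [← Matrix.det_mul, hH, Matrix.det_one]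
    rw [show Matrix.of (conjFun H x) = H * Matrix.of x * H from rfl, Matrix.det_mul,
      Matrix.det_mul]
    linear_combination (Matrix.of x).det * h2
  have h3 := det_border_conj x v a H hs hH
  rw [hv, det_border_single, hc] at h3
  rw [h1, leadingMinor, ← h3]
  rfl

/-- The even joint moments of the determinants of a GOE matrix of size `N` and of its leading
minor of size `N - 1`. -/
noncomputable def goeMoment : ℕ → ℕ → ℕ → ℝ
  -- A filler value: the recursion starts at size one.
  | 0, _, _ => 0
  | N + 1, m, i => ∫ x, (Matrix.of x).det ^ (2 * (m - i)) * leadingMinor x ^ (2 * i) ∂(goe (N + 1))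

/-- Fubini with the block integrated first, because rotation invariance is applied with the new
column held fixed. -/
theorem integral_goe_succ {N : ℕ} (α β : ℕ) :
    ∫ x, (Matrix.of x).det ^ α * leadingMinor x ^ β ∂(goe (N + 1))
      = ∫ p : (Fin N → ℝ) × ℝ, ∫ x, (Matrix.of (border x p.1 p.2)).det ^ α
        * (Matrix.of x).det ^ β ∂(goe N) ∂(goeColumn N) := by
  have hm : Measurable fun x : Fin (N + 1) → Fin (N + 1) → ℝ =>
      (Matrix.of x).det ^ α * leadingMinor x ^ β :=
    (measurable_det_of.pow_const α).mul (measurable_leadingMinor.pow_const β)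
  have hint : Integrable (fun x : Fin (N + 1) → Fin (N + 1) → ℝ =>
      (Matrix.of x).det ^ α * leadingMinor x ^ β) (goe (N + 1)) :=
    (((hasAllMoments_det_goe _).pow α).mul ((hasAllMoments_leadingMinor_goe _).pow β)).integrable
  rw [goe, integrable_map_measure hm.aestronglyMeasurable measurable_border.aemeasurable] at hint
  rw [goe, integral_map measurable_border.aemeasurable hm.aestronglyMeasurable]
  simp only [leadingMinor, submatrix_border, Function.comp_def] at hint ⊢
  exact integral_prod_symm _ hint

theorem sum_range_eq_sum_even {f : ℕ → ℝ} (hf : ∀ s, Odd s → f s = 0) (M : ℕ) :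
    ∑ s ∈ Finset.range (2 * M + 1), f s = ∑ j ∈ Finset.range (M + 1), f (2 * j) := by
  induction M with
  | zero => simp
  | succ M ih =>
    rw [show 2 * (M + 1) + 1 = 2 * M + 1 + 1 + 1 by ring, Finset.sum_range_succ,
      Finset.sum_range_succ, ih, hf (2 * M + 1) ⟨M, rfl⟩, Finset.sum_range_succ _ (M + 1), add_zero]
    rfl

/-- With the column fixed, rotate it, expand the power binomially, and then integrate the column. -/
theorem goeMoment_succ (N i M : ℕ) :
    goeMoment (N + 2) (i + M) i = ∑ j ∈ Finset.range (M + 1),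
      ((2 * M).choose (2 * j) : ℝ) * ((2 * (M - j)).factorial / (M - j).factorial)
        * chiMoment (N + 1 : ℕ) (2 * j) * goeMoment (N + 1) (i + M) j := by
  have hD := hasAllMoments_det_goe (N + 1)
  have hL := hasAllMoments_leadingMinor_goe N
  have hS : HasAllMoments (fun v : Fin (N + 1) → ℝ => ∑ i, v i ^ 2)
      (Measure.pi fun _ => gaussianReal 0 1) :=
    HasAllMoments.sum _ fun i _ => (hasAllMoments_pi_gaussianReal i).pow 2
  set T : ℕ → ℝ := fun s => ((2 * M).choose s : ℝ) * (-1) ^ s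
    * (∫ a, a ^ (2 * M - s) ∂(gaussianReal 0 2)) * chiMoment (N + 1 : ℕ) s
    * ∫ x, (Matrix.of x).det ^ (2 * M - s + 2 * i) * leadingMinor x ^ s ∂(goe (N + 1)) with hT
  have key : goeMoment (N + 2) (i + M) i = ∑ s ∈ Finset.range (2 * M + 1), T s := by
    rw [goeMoment, integral_goe_succ, show i + M - i = M by omega]
    simp_rw [integral_det_border]
    have h1 (p : (Fin (N + 1) → ℝ) × ℝ) :
        ∫ x, (p.2 * (Matrix.of x).det - (∑ i, p.1 i ^ 2) * leadingMinor x) ^ (2 * M)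
            * (Matrix.of x).det ^ (2 * i) ∂(goe (N + 1))
          = ∑ s ∈ Finset.range (2 * M + 1), (((2 * M).choose s : ℝ) * (-1) ^ s *
            ∫ x, (Matrix.of x).det ^ (2 * M - s + 2 * i) * leadingMinor x ^ s ∂(goe (N + 1)))
            * ((∑ i, p.1 i ^ 2) ^ s * p.2 ^ (2 * M - s)) := by
      have h2 (x : Fin (N + 1) → Fin (N + 1) → ℝ) :
          (p.2 * (Matrix.of x).det - (∑ i, p.1 i ^ 2) * leadingMinor x) ^ (2 * M)
            * (Matrix.of x).det ^ (2 * i)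
          = ∑ s ∈ Finset.range (2 * M + 1), (((2 * M).choose s : ℝ) * (-1) ^ s *
            ((∑ i, p.1 i ^ 2) ^ s * p.2 ^ (2 * M - s))) *
            ((Matrix.of x).det ^ (2 * M - s + 2 * i) * leadingMinor x ^ s) := by
        rw [sub_eq_neg_add, add_pow, Finset.sum_mul]
        refine Finset.sum_congr rfl fun s _ => ?_
        rw [pow_add, neg_pow, mul_pow, mul_pow]
        ring
      simp_rw [h2]
      rw [integral_finsetSum]
      · refine Finset.sum_congr rfl fun s _ => ?_
        rw [integral_const_mul]
        ring
      · intro s _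
        exact (((hD.pow _).mul (hL.pow _)).integrable).const_mul _
    simp_rw [h1]
    rw [integral_finsetSum]
    · refine Finset.sum_congr rfl fun s _ => ?_
      rw [integral_const_mul, goeColumn, integral_prod_mul
        (fun v : Fin (N + 1) → ℝ => (∑ i, v i ^ 2) ^ s) (fun a : ℝ => a ^ (2 * M - s)),
        integral_sum_sq_pow_pi_gaussianReal]
      simp only [hT]
      ring
    · intro s _
      unfold goeColumn
      exact ((((hS.pow s).comp_fst).mul
        (((hasAllMoments_gaussianReal 0 2).pow (2 * M - s)).comp_snd)).integrable).const_mul _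
  -- For odd `s` the corner entry carries the odd exponent `2 M - s`, so the signs `(-1)^s`
  -- disappear too.
  have hodd : ∀ s, Odd s → T s = 0 := by
    intro s hs
    simp only [hT]
    rcases le_or_gt s (2 * M) with h | h
    · rw [integral_odd_pow_gaussianReal 2 (Nat.Even.sub_odd h ⟨M, by ring⟩ hs)]
      ring
    · rw [Nat.choose_eq_zero_of_lt h]
      simp
  rw [key, sum_range_eq_sum_even hodd]
  refine Finset.sum_congr rfl fun j hj => ?_
  obtain ⟨d, rfl⟩ := Nat.exists_eq_add_of_le (Nat.lt_succ_iff.1 (Finset.mem_range.1 hj))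
  simp only [hT, goeMoment]
  rw [show 2 * (j + d) - 2 * j = 2 * d by omega, show j + d - j = d by omega,
    integral_even_pow_gaussianReal_two, show 2 * (i + (j + d) - j) = 2 * d + 2 * i by omega,
    Even.neg_one_pow ⟨j, by ring⟩]
  ring

theorem goeMoment_one (i M : ℕ) :
    goeMoment 1 (i + M) i = (2 * M).factorial / M.factorial := by
  rw [goeMoment, integral_goe_succ, show i + M - i = M by omega]
  have h (x : Fin 0 → Fin 0 → ℝ) (v : Fin 0 → ℝ) (a : ℝ) :
      (Matrix.of (border x v a)).det = a := by
    exact (Matrix.det_fin_one (Matrix.of (border x v a))).trans (border_last_last x v a)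
  simp only [h, Matrix.det_isEmpty, one_pow, mul_one, integral_const, probReal_univ,
    smul_eq_mul, one_mul]
  rw [goeColumn, ← integral_even_pow_gaussianReal_two]
  have h2 := integral_prod_mul (μ := Measure.pi fun _ : Fin 0 => gaussianReal 0 1)
    (ν := gaussianReal 0 2) (fun _ => (1 : ℝ)) (fun a : ℝ => a ^ (2 * M))
  simpa using h2

theorem isDetMomentRecursion_goeMoment : IsDetMomentRecursion goeMoment :=
  ⟨goeMoment_one, goeMoment_succ⟩

theorem integral_even_pow_det_goe (n m : ℕ) :
    ∫ x, (Matrix.of x).det ^ (2 * m) ∂(goe (2 * n + 1))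
      = (2 * m).factorial / m.factorial * ∏ t ∈ Finset.range n, chiMoment (2 * t + 3) (2 * m) := by
  rw [← isDetMomentRecursion_goeMoment.odd_eq n m, goeMoment]
  simp

theorem integral_odd_pow_det_goe (n : ℕ) {k : ℕ} (hk : Odd k) :
    ∫ x, (Matrix.of x).det ^ k ∂(goe (2 * n + 1)) = 0 := by
  have h : ∫ x, (Matrix.of x).det ^ k ∂(goe (2 * n + 1))
      = ∫ x, (Matrix.of (-x)).det ^ k ∂(goe (2 * n + 1)) := by
    conv_lhs => rw [← goe_map_neg]
    rw [integral_map (by fun_prop) (measurable_det_of.pow_const k).aestronglyMeasurable]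
  have h2 (x : Fin (2 * n + 1) → Fin (2 * n + 1) → ℝ) :
      (Matrix.of (-x)).det ^ k = -(Matrix.of x).det ^ k := by
    rw [show Matrix.of (-x) = -Matrix.of x from rfl, Matrix.det_neg, Fintype.card_fin,
      Odd.neg_one_pow ⟨n, rfl⟩, neg_one_mul, hk.neg_pow]
  simp_rw [h2, integral_neg] at h
  linarith

/-! ### Every GOE matrix has the law of the bordering model -/

/-- Only the entries on and above the diagonal are independent, so the pairing has to be folded onto
them. -/
theorem sum_sum_eq_sum_upper {N : ℕ} (f : Fin N → Fin N → ℝ) :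
    ∑ i, ∑ j, f i j = ∑ p : {p : Fin N × Fin N // p.1 ≤ p.2},
      if p.1.1 = p.1.2 then f p.1.1 p.1.1 else f p.1.1 p.1.2 + f p.1.2 p.1.1 := by
  have h1 : ∑ p : {p : Fin N × Fin N // p.1 ≤ p.2},
      (if p.1.1 = p.1.2 then f p.1.1 p.1.1 else f p.1.1 p.1.2 + f p.1.2 p.1.1)
      = ∑ i, ∑ j, if i ≤ j then (if i = j then f i i else f i j + f j i) else 0 := by
    rw [← Fintype.sum_prod_type'
      (f := fun i j => if i ≤ j then (if i = j then f i i else f i j + f j i) else 0),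
      ← Finset.sum_filter, ← Finset.sum_subtype_eq_sum_filter]
    simp
  have h2 : ∀ i j, (if i ≤ j then (if i = j then f i i else f i j + f j i) else 0)
      = (if i ≤ j then f i j else 0) + (if i < j then f j i else 0) := by
    intro i j
    rcases lt_trichotomy i j with h | rfl | h
    · simp [h.le, h.ne, h]
    · simp
    · simp [h.not_ge, h.not_gt]
  rw [h1]
  simp_rw [h2, Finset.sum_add_distrib]
  rw [Finset.sum_comm (f := fun i j => if i < j then f j i else 0), ← Finset.sum_add_distrib]
  refine Finset.sum_congr rfl fun i _ => ?_
  rw [← Finset.sum_add_distrib]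
  refine Finset.sum_congr rfl fun j _ => ?_
  rcases le_or_gt i j with h | h
  · simp [h, h.not_gt]
  · simp [h, h.not_ge]

namespace IsGOE

variable {Ω : Type*} [MeasurableSpace Ω] {N : ℕ} {M : Ω → Matrix (Fin N) (Fin N) ℝ}
  {P : Measure Ω}

theorem entry_comm (hM : IsGOE N M P) (i j : Fin N) :
    (fun ω => M ω i j) =ᵐ[P] fun ω => M ω j i := by
  filter_upwards [hM.isSymm] with ω h
  exact h.apply j i

theorem hasLaw_upper (hM : IsGOE N M P) (p : {p : Fin N × Fin N // p.1 ≤ p.2}) :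
    HasLaw (fun ω => M ω p.1.1 p.1.2) (gaussianReal 0 (if p.1.1 = p.1.2 then 2 else 1)) P := by
  obtain ⟨⟨i, j⟩, h⟩ := p
  rcases eq_or_lt_of_le h with h' | h'
  · simp only at h' ⊢
    subst h'
    simpa using hM.hasLaw_diag i
  · simpa [h'.ne] using hM.hasLaw_offDiag i j h'

theorem hasAllMoments_entry (hM : IsGOE N M P) (i j : Fin N) :
    HasAllMoments (fun ω => M ω i j) P := by
  have h : ∀ i j : Fin N, i ≤ j → HasAllMoments (fun ω => M ω i j) P := fun i j hij =>
    (hasAllMoments_gaussianReal 0 _).comp_hasLaw (hM.hasLaw_upper ⟨(i, j), hij⟩)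
  rcases le_total i j with hij | hij
  · exact h i j hij
  · exact (h j i hij).congr (hM.entry_comm j i)

theorem aemeasurable_entries (hM : IsGOE N M P) : AEMeasurable (fun ω i j => M ω i j) P :=
  aemeasurable_pi_lambda _ fun i => aemeasurable_pi_lambda _ fun j =>
    (hM.hasAllMoments_entry i j).integrable.aemeasurable

/-- Independence factors the characteristic function over the upper triangle; folding gives
variances `2 B_ii^2` and `(B_ij + B_ji)^2`, which add up to `goeVariance B`. -/
theorem hasGOECharFun [IsProbabilityMeasure P] (hM : IsGOE N M P) :
    HasGOECharFun (P.map fun ω i j => M ω i j) := by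
  intro B
  have hm := measurable_matrixPairing B
  rw [integral_map hM.aemeasurable_entries (by fun_prop)]
  set β : {p : Fin N × Fin N // p.1 ≤ p.2} → ℝ := fun p =>
    if p.1.1 = p.1.2 then B p.1.1 p.1.1 else B p.1.1 p.1.2 + B p.1.2 p.1.1 with hβ
  have h1 : (fun ω => Complex.exp ((matrixPairing B (fun i j => M ω i j) : ℝ) * Complex.I))
      =ᵐ[P] fun ω => ∏ p, (fun p (y : ℝ) => Complex.exp ((β p * y : ℝ) * Complex.I)) p
        (M ω p.1.1 p.1.2) := by
    filter_upwards [hM.isSymm] with ω h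
    rw [matrixPairing, sum_sum_eq_sum_upper, ← Complex.exp_sum, Complex.ofReal_sum, Finset.sum_mul]
    congr 1
    refine Finset.sum_congr rfl fun p _ => ?_
    congr 2
    simp only [hβ]
    split_ifs with hp
    · rw [hp]
    · rw [h.apply p.1.1 p.1.2]
      ring
  rw [integral_congr_ae h1, hM.iIndepFun_entries.integral_fun_prod_comp
    (f := fun p (y : ℝ) => Complex.exp ((β p * y : ℝ) * Complex.I))
    (fun p => (hM.hasLaw_upper p).aemeasurable) (fun p => by fun_prop)]
  have h2 (p : {p : Fin N × Fin N // p.1 ≤ p.2}) :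
      ∫ ω, Complex.exp ((β p * M ω p.1.1 p.1.2 : ℝ) * Complex.I) ∂P
        = Complex.exp ((-((if p.1.1 = p.1.2 then 2 else 1 : NNReal) * β p ^ 2) / 2 : ℝ) : ℂ) := by
    rw [← integral_cexp_gaussianReal, ← (hM.hasLaw_upper p).map_eq,
      integral_map (hM.hasLaw_upper p).aemeasurable (by fun_prop)]
  simp_rw [h2]
  rw [← Complex.exp_sum, ← Complex.ofReal_sum, goeVariance, sum_sum_eq_sum_upper,
    ← Finset.sum_div, Finset.sum_neg_distrib]
  congr 4
  refine Finset.sum_congr rfl fun p _ => ?_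
  simp only [hβ]
  split_ifs
  · push_cast
    ring
  · push_cast
    ring

theorem map_eq_goe [IsProbabilityMeasure P] (hM : IsGOE N M P) :
    P.map (fun ω i j => M ω i j) = goe N := by
  have := Measure.isProbabilityMeasure_map hM.aemeasurable_entries
  exact hM.hasGOECharFun.ext (hasGOECharFun_goe N)

theorem integral_det_pow [IsProbabilityMeasure P] (hM : IsGOE N M P) (k : ℕ) :
    ∫ ω, (M ω).det ^ k ∂P = ∫ x, (Matrix.of x).det ^ k ∂(goe N) := by
  rw [← hM.map_eq_goe, integral_map hM.aemeasurable_entries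
    (measurable_det_of.pow_const k).aestronglyMeasurable]
  rfl

end IsGOE

/-! ### The product side and the conclusion -/

theorem hasAllMoments_chiSquared {d : ℕ} (hd : 0 < d) :
    HasAllMoments (fun x => x) (chiSquared d) :=
  hasAllMoments_gammaMeasure (by positivity) (by norm_num)

theorem integral_sqrt_two_mul_prod_pow {n : ℕ} {Ω : Type*} [MeasurableSpace Ω] {P : Measure Ω}
    {X : Ω → ℝ} {Y : Fin n → Ω → ℝ} (hX : HasLaw X (gaussianReal 0 1) P)
    (hY : ∀ i : Fin n, HasLaw (Y i) (chiSquared (2 * (i + 1) + 1)) P)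
    (hXY : iIndepFun (fun j : Option (Fin n) => j.elim X Y) P) (k : ℕ) :
    ∫ ω, (√2 * X ω * ∏ i, Y i ω) ^ k ∂P
      = √2 ^ k * (∫ x, x ^ k ∂(gaussianReal 0 1))
        * ∏ t ∈ Finset.range n, chiMoment (2 * t + 3) k := by
  have h1 (ω : Ω) : (√2 * X ω * ∏ i, Y i ω) ^ k
      = √2 ^ k * ∏ j : Option (Fin n), (fun y : ℝ => y ^ k) (j.elim X Y ω) := by
    rw [Fintype.prod_option, mul_pow, mul_pow, Finset.prod_pow, mul_assoc]
    rfl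
  simp_rw [h1]
  rw [integral_const_mul, hXY.integral_fun_prod_comp (f := fun _ (y : ℝ) => y ^ k) ?_
    (fun _ => by fun_prop), Fintype.prod_option, mul_assoc]
  · congr 1
    congr 1
    · exact hX.integral_comp (f := fun y => y ^ k) (by fun_prop)
    · rw [Finset.prod_range]
      refine Finset.prod_congr rfl fun i _ => ?_
      have h2 := (hY i).integral_comp (f := fun y => y ^ k) (by fun_prop)
      rw [integral_pow_chiSquared (by positivity)] at h2
      simp only [Function.comp_def] at h2
      rw [show ((2 * (i + 1) + 1 : ℕ) : ℝ) = 2 * (i : ℕ) + 3 by push_cast; ring] at h2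
      exact h2
  · rintro (_ | i)
    · exact hX.aemeasurable
    · exact (hY i).aemeasurable

theorem theorem6 (n : ℕ)
    {Ω : Type*} [MeasurableSpace Ω] (P : Measure Ω) [IsProbabilityMeasure P]
    (M : Ω → Matrix (Fin (2 * n + 1)) (Fin (2 * n + 1)) ℝ) (hM : IsGOE (2 * n + 1) M P)
    {Ω' : Type*} [MeasurableSpace Ω'] (P' : Measure Ω') [IsProbabilityMeasure P']
    (X : Ω' → ℝ) (Y : Fin n → Ω' → ℝ)
    (hX : HasLaw X (gaussianReal 0 1) P')
    (hY : ∀ i : Fin n, HasLaw (Y i) (chiSquared (2 * (i + 1) + 1)) P')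
    (hXY : iIndepFun (fun j : Option (Fin n) => j.elim X Y) P')
    (k : ℕ) :
    Integrable (fun ω => (M ω).det ^ k) P ∧
    Integrable (fun ω => (√2 * X ω * ∏ i, Y i ω) ^ k) P' ∧
    ∫ ω, (M ω).det ^ k ∂P = ∫ ω, (√2 * X ω * ∏ i, Y i ω) ^ k ∂P' := by
  have hdet : HasAllMoments (fun ω => (M ω).det) P :=
    HasAllMoments.det fun i j => hM.hasAllMoments_entry i j
  have hX' : HasAllMoments X P' := (hasAllMoments_gaussianReal 0 1).comp_hasLaw hX
  have hY' (i : Fin n) : HasAllMoments (Y i) P' :=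
    (hasAllMoments_chiSquared (by positivity)).comp_hasLaw (hY i)
  refine ⟨(hdet.pow k).integrable, ?_, ?_⟩
  · exact ((((HasAllMoments.const _).mul hX').mul
      (HasAllMoments.prod _ fun i _ => hY' i)).pow k).integrable
  · rw [hM.integral_det_pow, integral_sqrt_two_mul_prod_pow hX hY hXY]
    rcases Nat.even_or_odd' k with ⟨m, rfl | rfl⟩
    -- The products over `t` agree; what remains is `2^m * chiMoment 1 m = (2m)! / m!`.
    · rw [integral_even_pow_det_goe, integral_even_pow_gaussianReal, chiMoment_one_eq, pow_mul,
        Real.sq_sqrt (by norm_num)]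
      congr 1
      field_simp
    · rw [integral_odd_pow_det_goe n ⟨m, rfl⟩, integral_odd_pow_gaussianReal 1 ⟨m, rfl⟩]
      ring
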